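/- **Proposition 9.2.** Let $m\ge 1$ and let $(M,D)$ be a locally flat manifold of dimension $m$, i.e. a smooth (Hausdorff, second countable) $m$-manifold $M$ with a smooth linear connection $D$ on $TM$ whose torsion and curvature vanish. Let $p:(\tilde M,\tilde D)\to(M,D)$ be its universal covering: $\tilde M$ is simply connected, $p$ is a surjective covering map and a smooth local diffeomorphism, and $\tilde D=p^*D$. A developing map is a smooth local diffeomorphism $\mathrm{dev}:\tilde M\to\mathbb R^m$ such that $\tilde D$ is the pull-back of the standard flat connection of $\mathbb R^m$; every deck transformation $\gamma$ of $p$ then satisfies $\mathrm{dev}\circ\gamma=L_\gamma\circ\mathrm{dev}+b_\gamma$ with $L_\gamma$ linear and $b_\gamma\in\mathbb R^m$, and the linear maps $L_\gamma$ form the linear holonomy $\ell(\Gamma)$. Let $\tilde{\mathcal A}$ be the Koszul–Vinberg algebra of $(\tilde M,\tilde D)$, i.e. the space of smooth vector fields on $\tilde M$ with product $ab=\tilde D_ab$, and let $\tilde W=C^\infty(\tilde M,\mathbb R)$ be its left Koszul–Vinberg module, with $aw=\langle dw,a\rangle$ and $wa=0$. For $q\ge1$ let $C_q(\tilde{\mathcal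 A},\tilde W)$ be the space of all $\mathbb R$-$q$-linear maps $\tilde{\mathcal A}^q\to\tilde W$; let $C_0(\tilde{\mathcal A},\tilde W)=J(\tilde W)=\{w:(ab)w=a(bw)\text{ for all }a,b\in\tilde{\mathcal A}\}$. The coboundary $\delta:C_q\to C_{q+1}$ is $(\delta w)(a)=-aw+wa$ for $q=0$ and, for $q\ge1$, $$(\delta f)(a_1,\dots,a_{q+1})=\sum_{j=1}^{q}(-1)^j\Big\{(a_jf)(a_1,\dots,\hat a_j,\dots,a_{q+1})+\big(f(a_1,\dots,\hat a_j,\dots,a_q,a_j)\big)a_{q+1}\Big\},$$ where $(af)(b_1,\dots,b_q)=a\big(f(b_1,\dots,b_q)\big)-\sum_i f(b_1,\dots,ab_i,\dots,b_q)$. For $q\ge 1$ let $H^q(\tilde{\mathcal A},\tilde W)$ be the quotient of the $q$-cocycles by the $q$-coboundaries. Suppose that $(M,D)$ is complete (every tangent vector is the initial velocity of a geodesic of $D$ defined on all of $\mathbb R$) and that its linear holonomy is unimodular ($\ell(\Gamma)\subset SL(m,\mathbb R)$). Then $\tilde M$ carries a $\tilde D$-parallel volume form, and every $\tilde D$-parallel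 volume form $\tilde v$ on $\tilde M$, regarded as the cochain $(a_1,\dots,a_m)\mapsto\tilde v(a_1,\dots,a_m)$ in $C_m(\tilde{\mathcal A},\tilde W)$, is a cocycle whose class in $H^m(\tilde{\mathcal A},\tilde W)$ is zero. -/

import Mathlib

namespace KV

/-- A Koszul-Vinberg (left symmetric) algebra structure on an `F`-vector space `A`. -/
structure Algebra (F A : Type*) [Field F] [AddCommGroup A] [Module F A] where
  /-- the product `(a, b) ↦ ab` -/
  mul : A →ₗ[F] A →ₗ[F] A
  /-- `(a, b, c) = (b, a, c)`, where `(a, b, c) = (ab)c - a(bc)` -/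
  assoc_comm : ∀ a b c : A,
    mul (mul a b) c - mul a (mul b c) = mul (mul b a) c - mul b (mul a c)

/-- A (two-sided) Koszul-Vinberg module structure on `W` over a Koszul-Vinberg algebra. -/
structure Mod {F A : Type*} [Field F] [AddCommGroup A] [Module F A] (K : Algebra F A)
    (W : Type*) [AddCommGroup W] [Module F W] where
  /-- the left action `(a, w) ↦ aw` -/
  left : A →ₗ[F] W →ₗ[F] W
  /-- the right action `(w, a) ↦ wa` -/
  right : W →ₗ[F] A →ₗ[F] W
  /-- `(a, b, w) = (b, a, w)` -/
  assoc_left : ∀ (a b : A) (w : W),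
    left (K.mul a b) w - left a (left b w) = left (K.mul b a) w - left b (left a w)
  /-- `(a, w, b) = (w, a, b)` -/
  assoc_right : ∀ (a b : A) (w : W),
    right (left a w) b - left a (right w b) = right (right w a) b - right w (K.mul a b)

section Cohomology

variable {F A W : Type*} [Field F] [AddCommGroup A] [Module F A] [AddCommGroup W] [Module F W]
  {K : Algebra F A} (N : Mod K W)

/-- The subspace `J(W)` of Jacobi elements: those `w` with `(a, b, w) = 0` for all `a, b`. -/
def jacobi : Submodule F W where
  carrier := {w | ∀ a b : A, N.left (K.mul a b) w - N.left a (N.left b w) = 0}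
  zero_mem' := by intro a b; simp
  add_mem' := by
    intro v w hv hw a b
    have h1 := hv a b
    have h2 := hw a b
    rw [sub_eq_zero] at h1 h2 ⊢
    simp [h1, h2]
  smul_mem' := by
    intro c w hw a b
    have h1 := hw a b
    rw [sub_eq_zero] at h1 ⊢
    simp [h1]

theorem compLinearMap_update_apply {q : ℕ} (f : MultilinearMap F (fun _ : Fin q => A) W)
    (i : Fin q) (u : A →ₗ[F] A) (b : Fin q → A) :
    f.compLinearMap (Function.update (fun _ => LinearMap.id) i u) b =
      f (Function.update b i (u (b i))) := by
  rw [MultilinearMap.compLinearMap_apply]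
  congr 1
  ext k
  by_cases h : k = i
  · subst h; simp
  · simp [h]

/-- The left action of `A` on `q`-linear maps:
`(af)(b₁, …, b_q) = a (f (b₁, …, b_q)) - ∑ᵢ f (b₁, …, a bᵢ, …, b_q)`. -/
def leftAct (q : ℕ) : A →ₗ[F] MultilinearMap F (fun _ : Fin q => A) W →ₗ[F]
    MultilinearMap F (fun _ : Fin q => A) W :=
  LinearMap.mk₂ F
    (fun a f => (N.left a).compMultilinearMap f -
      ∑ i : Fin q, f.compLinearMap (Function.update (fun _ => LinearMap.id) i (K.mul a)))
    (by
      intro a a' f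
      ext b
      simp only [sub_apply, add_apply, sum_apply,
        compLinearMap_update_apply, LinearMap.compMultilinearMap_apply, map_add,
        LinearMap.add_apply, MultilinearMap.map_update_add, Finset.sum_add_distrib]
      abel)
    (by
      intro c a f
      ext b
      simp only [sub_apply, smul_apply, sum_apply,
        compLinearMap_update_apply, LinearMap.compMultilinearMap_apply, map_smul,
        LinearMap.smul_apply, MultilinearMap.map_update_smul, Finset.smul_sum, smul_sub])
    (by
      intro a f f'
      ext b
      simp only [sub_apply, add_apply, sum_apply,
        compLinearMap_update_apply, LinearMap.compMultilinearMap_apply, map_add,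
        Finset.sum_add_distrib]
      abel)
    (by
      intro c a f
      ext b
      simp only [sub_apply, smul_apply, sum_apply,
        compLinearMap_update_apply, LinearMap.compMultilinearMap_apply, map_smul,
        Finset.smul_sum, smul_sub])

/-- The right action of `A` on `q`-linear maps: `(fa)(b₁, …, b_q) = (f (b₁, …, b_q)) a`. -/
def rightAct (q : ℕ) : A →ₗ[F] MultilinearMap F (fun _ : Fin q => A) W →ₗ[F]
    MultilinearMap F (fun _ : Fin q => A) W :=
  LinearMap.mk₂ F (fun a f => (N.right.flip a).compMultilinearMap f)
    (by intros; ext; simp) (by intros; ext; simp) (by intros; ext; simp) (by intros; ext; simp)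

/-- The `j`-th summand `(a_j f)(…, â_j, …, a_{q+1})` -/
def leftTerm (q : ℕ) (j : Fin (q + 1)) : MultilinearMap F (fun _ : Fin q => A) W →ₗ[F]
    MultilinearMap F (fun _ : Fin (q + 1) => A) W where
  toFun f := LinearMap.uncurryMid j ((leftAct N q).flip f)
  map_add' := by intros; ext; simp
  map_smul' := by intros; ext; simp

/-- The summand `(e_q(a_j)(f a_{q+1}))(a_1, …, â_j, …, a_q)`,
i.e. `(f (a_1, …, â_j, …, a_q, a_j)) a_{q+1}`. -/
def rightTerm (q : ℕ) (j : Fin (q + 1)) : MultilinearMap F (fun _ : Fin (q + 1) => A) W →ₗ[F]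
    MultilinearMap F (fun _ : Fin (q + 2) => A) W where
  toFun f := LinearMap.uncurryMid (Fin.last (q + 1))
    { toFun := fun a => LinearMap.uncurryMid j
        (MultilinearMap.curryMid (Fin.last q) (rightAct N (q + 1) a f))
      map_add' := by intros; ext; simp
      map_smul' := by intros; ext; simp }
  map_add' := by intros; ext; simp
  map_smul' := by intros; ext; simp

/-- The coboundary operator `δ : C_q(A, W) → C_{q+1}(A, W)`: for `q = 0` it is
`(δw)(a) = -aw + wa`, and for `q ≥ 1`
`(δf)(a_1, …, a_{q+1}) = ∑_{1 ≤ j ≤ q} (-1)^j {(a_j f)(a_1, …, â_j, …, a_{q+1})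
  + (f (a_1, …, â_j, …, a_q, a_j)) a_{q+1}}`. See `coboundary_zero_apply` and
`coboundary_succ_apply`. -/
def coboundary : (q : ℕ) → MultilinearMap F (fun _ : Fin q => A) W →ₗ[F]
    MultilinearMap F (fun _ : Fin (q + 1) => A) W
  | 0 =>
    { toFun := fun w => LinearMap.uncurryMid 0
        { toFun := fun a => rightAct N 0 a w - leftAct N 0 a w
          map_add' := by intros; ext; simp; abel
          map_smul' := by intros; ext; simp [smul_sub] }
      map_add' := by intros; ext; simp; abel
      map_smul' := by intros; ext; simp [smul_sub] }
  | q + 1 => ∑ j : Fin (q + 1),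
      (-1 : F) ^ ((j : ℕ) + 1) • (leftTerm N (q + 1) j.castSucc + rightTerm N q j)

theorem leftAct_apply (q : ℕ) (a : A) (f : MultilinearMap F (fun _ : Fin q => A) W)
    (b : Fin q → A) : leftAct N q a f b =
      N.left a (f b) - ∑ i : Fin q, f (Function.update b i (K.mul a (b i))) := by
  simp only [leftAct, LinearMap.mk₂_apply, sub_apply, sum_apply, compLinearMap_update_apply,
    LinearMap.compMultilinearMap_apply]

theorem coboundary_zero_apply (w : MultilinearMap F (fun _ : Fin 0 => A) W) (a : Fin 1 → A) :
    coboundary N 0 w a = - N.left (a 0) (w ![]) + N.right (w ![]) (a 0) := by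
  have h : (Fin.removeNth 0 a : Fin 0 → A) = ![] := Subsingleton.elim _ _
  simp [coboundary, leftAct_apply, rightAct, h]
  abel

theorem coboundary_succ_apply (q : ℕ) (f : MultilinearMap F (fun _ : Fin (q + 1) => A) W)
    (a : Fin (q + 2) → A) :
    coboundary N (q + 1) f a = ∑ j : Fin (q + 1), (-1 : F) ^ ((j : ℕ) + 1) •
      (leftAct N (q + 1) (a j.castSucc) f (Fin.removeNth j.castSucc a) +
        N.right (f (Fin.snoc (α := fun _ => A) (Fin.removeNth j (Fin.init a)) (a j.castSucc)))
          (a (Fin.last (q + 1)))) := by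
  simp only [coboundary, sum_apply, LinearMap.sum_apply]
  refine Finset.sum_congr rfl fun j _ => ?_
  simp [leftTerm, rightTerm, rightAct, Fin.init]

/-- `C_q(A, W)`: all `q`-linear maps for `q ≥ 1`, and `C_0(A, W) = J(W)`. -/
def cochains : (q : ℕ) → Submodule F (MultilinearMap F (fun _ : Fin q => A) W)
  | 0 =>
    { carrier := {f | f ![] ∈ jacobi N}
      zero_mem' := (jacobi N).zero_mem
      add_mem' := fun hf hg => (jacobi N).add_mem hf hg
      smul_mem' := fun c _ hf => (jacobi N).smul_mem c hf }
  | _ + 1 => ⊤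

/-- The `q`-cocycles. -/
def cocycles (q : ℕ) : Submodule F (MultilinearMap F (fun _ : Fin q => A) W) :=
  cochains N q ⊓ LinearMap.ker (coboundary N q)

/-- The `q`-coboundaries: `δ C_{q-1}(A, W)`, and `0` for `q = 0`. -/
def coboundaries : (q : ℕ) → Submodule F (MultilinearMap F (fun _ : Fin q => A) W)
  | 0 => ⊥
  | q + 1 => (cochains N q).map (coboundary N q)

/-- The Koszul-Vinberg cohomology space `H^q(A, W)`: cocycles modulo coboundaries. -/
abbrev Cohomology (q : ℕ) : Type _ :=
  cocycles N q ⧸ (coboundaries N q).comap (cocycles N q).subtype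

end Cohomology

end KV

open scoped Manifold ContDiff

noncomputable section

namespace FlatManifold

/-- The model vector space `ℝᵐ`. -/
abbrev Model (m : ℕ) : Type := EuclideanSpace ℝ (Fin m)

/-- The space `𝔛(M)` of smooth vector fields on an `m`-dimensional manifold. -/
abbrev VField (m : ℕ) (M : Type*) [TopologicalSpace M] [ChartedSpace (Model m) M]
    [IsManifold (𝓡 m) ∞ M] : Type _ :=
  ContMDiffSection (𝓡 m) (Model m) ∞ (TangentSpace (𝓡 m) : M → Type _)

/-- The space `W = C^∞(M, ℝ)`. -/
abbrev SmoothFun (m : ℕ) (M : Type*) [TopologicalSpace M] [ChartedSpace (Model m) M] : Type _ :=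
  ContMDiffMap (𝓡 m) 𝓘(ℝ, ℝ) M ℝ ∞

/-- Linear connections on `M`, i.e. covariant derivatives on the tangent bundle. In Mathlib's
argument order, `D Y x u` is `(D_u Y)(x)`. -/
abbrev Connection (m : ℕ) (M : Type*) [TopologicalSpace M] [ChartedSpace (Model m) M]
    [IsManifold (𝓡 m) ∞ M] : Type _ :=
  CovariantDerivative (𝓡 m) (Model m) (TangentSpace (𝓡 m) : M → Type _)

section Basic

variable {m : ℕ} {M : Type*} [TopologicalSpace M] [ChartedSpace (Model m) M]
  [IsManifold (𝓡 m) ∞ M]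

instance isManifold_minSmoothness : IsManifold (𝓡 m) (minSmoothness ℝ 3) M := by
  rw [minSmoothness_of_isRCLikeNormedField]
  infer_instance

/-- `D` is a locally flat structure: a smooth linear connection whose torsion and curvature
tensors vanish. -/
structure IsLocallyFlat (D : Connection m M) : Prop where
  smooth : CovariantDerivative.ContMDiffCovariantDerivative D ∞
  torsion : D.torsion = 0
  /-- `D_X D_Y Z - D_Y D_X Z - D_[X,Y] Z = 0` -/
  curvature : ∀ (X Y Z : VField m M) (x : M),
    D (fun y => D Z y (Y y)) x (X x) - D (fun y => D Z y (X y)) x (Y x)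
      - D Z x (VectorField.mlieBracket (𝓡 m) X Y x) = 0

/-- The derivative `⟨dw, a⟩` of a function along a vector field. -/
def lieD (a : VField m M) (w : SmoothFun m M) : SmoothFun m M :=
  ⟨fun x => mvfderiv (𝓡 m) w x (a x), by
    have h1 : ContMDiff (𝓡 m).tangent 𝓘(ℝ, ℝ).tangent ∞ (tangentMap (𝓡 m) 𝓘(ℝ, ℝ) w) :=
      w.contMDiff.contMDiff_tangentMap (by simp)
    exact (contMDiff_snd_tangentBundle_modelSpace ℝ 𝓘(ℝ, ℝ)).comp (h1.comp a.contMDiff)⟩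

/-- The vector field `D_a b`. -/
def covD (D : Connection m M) (hD : CovariantDerivative.ContMDiffCovariantDerivative D ∞) (a b : VField m M) :
    VField m M :=
  ⟨fun x => D b x (a x), by
    have h := hD.contMDiff.contMDiff (σ := b) (by simpa [contMDiffOn_univ] using b.contMDiff)
    rw [contMDiffOn_univ] at h
    exact h.clm_bundle_apply a.contMDiff⟩

theorem lieD_add (a : VField m M) (w w' : SmoothFun m M) :
    lieD a (w + w') = lieD a w + lieD a w' := by
  ext x
  exact congr($(mvfderiv_add (w.contMDiff.mdifferentiable (by simp) x)
    (w'.contMDiff.mdifferentiable (by simp) x)) (a x))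

theorem lieD_smul (c : ℝ) (a : VField m M) (w : SmoothFun m M) :
    lieD a (c • w) = c • lieD a w := by
  ext x
  have h := mvfderiv_smul (I := 𝓡 m) (a := fun _ : M => c) mdifferentiableAt_const
    (w.contMDiff.mdifferentiable (by simp) x)
  rw [mvfderiv_const] at h
  have h2 := congr($h (a x))
  simp only [add_apply, smul_apply, ContinuousLinearMap.smulRight_apply, zero_apply, zero_smul, add_zero] at h2
  exact h2

open VectorField in
/-- `[X, Y] w = X(Yw) - Y(Xw)`. -/
theorem lieD_bracket (X Y : VField m M) (w : SmoothFun m M) (x : M) :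
    mvfderiv (𝓡 m) w x (mlieBracket (𝓡 m) X Y x) =
      lieD X (lieD Y w) x - lieD Y (lieD X w) x := by
  rcases subsingleton_or_nontrivial (Model m) with hs | hs
  · have h0 : ∀ (f : SmoothFun m M) (u : TangentSpace (𝓡 m) x), mvfderiv (𝓡 m) f x u = 0 := by
      intro f u
      have : u = 0 := Subsingleton.elim (α := Model m) _ _
      rw [this, map_zero]
    rw [h0]
    change 0 = mvfderiv (𝓡 m) (lieD Y w) x (X x) - mvfderiv (𝓡 m) (lieD X w) x (Y x)
    rw [h0, h0, sub_zero]
  · obtain ⟨z, hz⟩ := exists_ne (0 : Model m)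
    let Z : ∀ y : M, TangentSpace (𝓡 m) y :=
      FiberBundle.extend (Model m) (E := (TangentSpace (𝓡 m) : M → Type _)) (x := x) z
    have hZx : Z x = z := FiberBundle.extend_apply_self ..
    have hZ : ContMDiffAt (𝓡 m) ((𝓡 m).prod 𝓘(ℝ, Model m)) 2
        (fun y => (⟨y, Z y⟩ : TangentBundle (𝓡 m) M)) x :=
      FiberBundle.contMDiffAt_extend (𝓡 m) (Model m) (V := (TangentSpace (𝓡 m) : M → Type _)) (x := x) z
    have hZe : ∀ᶠ y in nhds x, MDifferentiableAt (𝓡 m) ((𝓡 m).prod 𝓘(ℝ, Model m))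
        (fun y => (⟨y, Z y⟩ : TangentBundle (𝓡 m) M)) y := by
      filter_upwards [contMDiffAt_iff_contMDiffAt_nhds (by simp) |>.1 hZ] with y hy using hy.mdifferentiableAt (by simp)
    have hw : ∀ (f : SmoothFun m M) y, MDifferentiableAt (𝓡 m) 𝓘(ℝ, ℝ) f y :=
      fun f y => f.contMDiff.mdifferentiable (by simp) y
    have e1 : ∀ V : VField m M, mlieBracket (𝓡 m) V (⇑w • Z) =ᶠ[nhds x]
        ⇑(lieD V w) • Z + ⇑w • mlieBracket (𝓡 m) V Z := by
      intro V
      filter_upwards [hZe] with y hy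
      exact mlieBracket_smul_right (hw w y) hy
    have hVZ : ∀ V : VField m M, MDifferentiableAt (𝓡 m) ((𝓡 m).prod 𝓘(ℝ, Model m))
        (fun y => (⟨y, mlieBracket (𝓡 m) V Z y⟩ : TangentBundle (𝓡 m) M)) x := by
      intro V
      have : IsManifold (𝓡 m) (((2 : ℕ∞) : WithTop ℕ∞) + 1) M := by
        have h3 : ((2 : ℕ∞) : WithTop ℕ∞) + 1 = 3 := by norm_cast
        rw [h3]
        infer_instance
      have := ContMDiffAt.mlieBracket_vectorField (m := 1) (n := 2) (I := 𝓡 m) (U := V) (V := Z) (x := x)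
        (V.contMDiff.contMDiffAt.of_le (by norm_cast)) hZ
        (by rw [minSmoothness_of_isRCLikeNormedField]; norm_num)
      exact this.mdifferentiableAt (by simp)
    have hZ1 := hZe.self_of_nhds
    have e2 : ∀ U V : VField m M, mlieBracket (𝓡 m) U (mlieBracket (𝓡 m) V (⇑w • Z)) x =
        (mvfderiv (𝓡 m) (lieD V w) x (U x) • Z x + lieD V w x • mlieBracket (𝓡 m) U Z x) +
        (mvfderiv (𝓡 m) w x (U x) • mlieBracket (𝓡 m) V Z x +
          w x • mlieBracket (𝓡 m) U (mlieBracket (𝓡 m) V Z) x) := by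
      intro U V
      refine (Filter.EventuallyEq.mlieBracket_vectorField_eq
        (Filter.EventuallyEq.refl _ (⇑U)) (e1 V)).trans ?_
      rw [mlieBracket_add_right, mlieBracket_smul_right (hw _ x) hZ1,
        mlieBracket_smul_right (hw _ x) (hVZ V)]
      · exact (hw _ x).smul_section hZ1
      · exact (hw _ x).smul_section (hVZ V)
    have hJ : ∀ W : ∀ y : M, TangentSpace (𝓡 m) y, ContMDiffAt (𝓡 m) ((𝓡 m).prod 𝓘(ℝ, Model m)) 2
        (fun y => (⟨y, W y⟩ : TangentBundle (𝓡 m) M)) x →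
        mlieBracket (𝓡 m) X (mlieBracket (𝓡 m) Y W) x =
          mlieBracket (𝓡 m) (mlieBracket (𝓡 m) X Y) W x +
            mlieBracket (𝓡 m) Y (mlieBracket (𝓡 m) X W) x := by
      intro W hW
      have h2 : minSmoothness ℝ 2 = 2 := minSmoothness_of_isRCLikeNormedField
      refine leibniz_identity_mlieBracket_apply ?_ ?_ ?_ <;> rw [h2]
      · exact X.contMDiff.contMDiffAt.of_le (by norm_cast)
      · exact Y.contMDiff.contMDiffAt.of_le (by norm_cast)
      · exact hW
    have j1 := hJ Z hZ
    have j2 := hJ (⇑w • Z) ((w.contMDiff.contMDiffAt.of_le (by norm_cast)).smul_section hZ)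
    rw [e2, e2, mlieBracket_smul_right (hw _ x) hZ1, j1] at j2
    have key : (mvfderiv (𝓡 m) (lieD Y w) x (X x) - mvfderiv (𝓡 m) (lieD X w) x (Y x) -
        mvfderiv (𝓡 m) w x (mlieBracket (𝓡 m) X Y x)) • Z x = 0 := by
      have hX : lieD X w x = mvfderiv (𝓡 m) w x (X x) := rfl
      have hY : lieD Y w x = mvfderiv (𝓡 m) w x (Y x) := rfl
      rw [hX, hY] at j2
      rw [sub_smul, sub_smul, sub_sub, sub_eq_zero]
      rw [smul_add] at j2
      generalize mvfderiv (𝓡 m) (lieD Y w) x (X x) • Z x = t1 at *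
      generalize mvfderiv (𝓡 m) (lieD X w) x (Y x) • Z x = t2 at *
      generalize mvfderiv (𝓡 m) w x (mlieBracket (𝓡 m) X Y x) • Z x = t3 at *
      rw [← sub_eq_zero] at j2 ⊢
      rw [← j2]
      abel
    have hz' : Z x ≠ 0 := by rw [hZx]; exact hz
    rw [smul_eq_zero, or_iff_left hz'] at key
    change _ = mvfderiv (𝓡 m) (lieD Y w) x (X x) - mvfderiv (𝓡 m) (lieD X w) x (Y x)
    linarith

theorem lieBracket_eq {D : Connection m M} (h : IsLocallyFlat D) (X Y : VField m M) :
    VectorField.mlieBracket (𝓡 m) X Y = ⇑(covD D h.smooth X Y - covD D h.smooth Y X) := by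
  funext x
  have := (D.torsion_eq_zero_iff.1 h.torsion)
    (X.contMDiff.mdifferentiable (by simp) x) (Y.contMDiff.mdifferentiable (by simp) x)
  rw [← this]
  rfl

/-- The Koszul-Vinberg algebra `𝒜 = (𝔛(M), D)` of a locally flat manifold: `ab = D_a b`. -/
def kvAlgebra (D : Connection m M) (h : IsLocallyFlat D) : KV.Algebra ℝ (VField m M) where
  mul := LinearMap.mk₂ ℝ (covD D h.smooth)
    (by intro a a' b; ext x; exact map_add (D b x) _ _)
    (by intro c a b; ext x; exact map_smul (D b x) _ _)
    (by
      intro a b b'; ext x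
      exact congr($(D.isCovariantDerivativeOnUniv.add (b.contMDiff.mdifferentiable (by simp) x)
        (b'.contMDiff.mdifferentiable (by simp) x)) (a x)))
    (by
      intro c a b; ext x
      exact congr($(D.isCovariantDerivativeOnUniv.smul_const c
        (b.contMDiff.mdifferentiable (by simp) x)) (a x)))
  assoc_comm a b c := by
    ext x
    have h1 := h.curvature a b c x
    rw [lieBracket_eq h] at h1
    have h2 : D c x ((covD D h.smooth a b - covD D h.smooth b a : VField m M) x) =
      covD D h.smooth (covD D h.smooth a b) c x - covD D h.smooth (covD D h.smooth b a) c x :=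
      map_sub (D c x) _ _
    rw [h2] at h1
    change covD D h.smooth (covD D h.smooth a b) c x - covD D h.smooth a (covD D h.smooth b c) x =
      covD D h.smooth (covD D h.smooth b a) c x - covD D h.smooth b (covD D h.smooth a c) x
    change covD D h.smooth a (covD D h.smooth b c) x - covD D h.smooth b (covD D h.smooth a c) x -
      (covD D h.smooth (covD D h.smooth a b) c x - covD D h.smooth (covD D h.smooth b a) c x) = 0 at h1
    rw [sub_eq_zero, sub_eq_iff_eq_add] at h1
    rw [sub_eq_sub_iff_add_eq_add, add_comm, h1]
    abel

/-- The left Koszul-Vinberg module `W = C^∞(M, ℝ)`: `aw = ⟨dw, a⟩` and `wa = 0`. -/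
def kvModule (D : Connection m M) (h : IsLocallyFlat D) :
    KV.Mod (kvAlgebra D h) (SmoothFun m M) where
  left := LinearMap.mk₂ ℝ lieD
    (by intro a a' w; ext x; exact map_add (mvfderiv (𝓡 m) w x) _ _)
    (by intro c a w; ext x; exact map_smul (mvfderiv (𝓡 m) w x) _ _)
    lieD_add (fun c a w => lieD_smul c a w)
  right := 0
  assoc_left a b w := by
    ext x
    have h1 := lieD_bracket a b w x
    rw [lieBracket_eq h] at h1
    have h2 : mvfderiv (𝓡 m) w x ((covD D h.smooth a b - covD D h.smooth b a : VField m M) x) =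
      lieD (covD D h.smooth a b) w x - lieD (covD D h.smooth b a) w x :=
      map_sub (mvfderiv (𝓡 m) w x) _ _
    rw [h2] at h1
    change lieD (covD D h.smooth a b) w x - lieD a (lieD b w) x =
      lieD (covD D h.smooth b a) w x - lieD b (lieD a w) x
    linarith
  assoc_right a b w := by
    change (0 : SmoothFun m M) - LinearMap.mk₂ ℝ lieD _ _ _ _ a 0 = 0 - 0
    rw [map_zero]

/-- A smooth differential `k`-form on `M`: an alternating `k`-form on each tangent space whose
values on smooth vector fields are smooth functions. -/
structure DiffForm (m : ℕ) (M : Type*) [TopologicalSpace M] [ChartedSpace (Model m) M]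
    [IsManifold (𝓡 m) ∞ M] (k : ℕ) where
  /-- the value at a point -/
  form : ∀ x : M, (TangentSpace (𝓡 m) x) [⋀^Fin k]→ₗ[ℝ] ℝ
  smooth : ∀ X : Fin k → VField m M,
    ContMDiff (𝓡 m) 𝓘(ℝ, ℝ) ∞ (fun x => form x (fun i => X i x))

/-- The cochain `(X₁, …, X_k) ↦ v(X₁, …, X_k)` in `C_k(𝒜, W)` given by a differential form. -/
def DiffForm.toCochain {k : ℕ} (v : DiffForm m M k) :
    MultilinearMap ℝ (fun _ : Fin k => VField m M) (SmoothFun m M) where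
  toFun X := ⟨fun x => v.form x (fun i => X i x), v.smooth X⟩
  map_update_add' := by
    intro inst X i Y Z
    ext x
    have h : ∀ U : VField m M, (fun j => (Function.update X i U) j x) =
        Function.update (fun j => X j x) i (U x) := by
      intro U
      funext j
      by_cases hj : j = i
      · subst hj; simp
      · simp [hj]
    change v.form x (fun j => (Function.update X i (Y + Z)) j x) =
      v.form x (fun j => (Function.update X i Y) j x) +
        v.form x (fun j => (Function.update X i Z) j x)
    rw [h, h, h]
    exact (v.form x).map_update_add _ i (Y x) (Z x)
  map_update_smul' := by
    intro inst X i c Y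
    ext x
    have h : ∀ U : VField m M, (fun j => (Function.update X i U) j x) =
        Function.update (fun j => X j x) i (U x) := by
      intro U
      funext j
      by_cases hj : j = i
      · subst hj; simp
      · simp [hj]
    change v.form x (fun j => (Function.update X i (c • Y)) j x) =
      c • v.form x (fun j => (Function.update X i Y) j x)
    rw [h, h]
    exact (v.form x).map_update_smul _ i c (Y x)

/-- `v` is a volume form: a nowhere vanishing form of top degree. -/
def DiffForm.IsVolume (v : DiffForm m M m) : Prop := ∀ x, v.form x ≠ 0

/-- `v` is `D`-parallel: `(D_a v)(b₁, …, b_k) = a(v(b₁, …, b_k)) - ∑ᵢ v(b₁, …, D_a bᵢ, …, b_k)`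
vanishes for all vector fields. -/
def DiffForm.IsParallel {k : ℕ} (v : DiffForm m M k) (D : Connection m M)
    (h : IsLocallyFlat D) : Prop :=
  ∀ (a : VField m M) (b : Fin k → VField m M),
    lieD a (v.toCochain b) =
      ∑ i : Fin k, v.toCochain (Function.update b i (covD D h.smooth a (b i)))

/-- The velocity vector of a curve. -/
def velocity (c : ℝ → M) (t : ℝ) : TangentSpace (𝓡 m) (c t) :=
  mfderiv 𝓘(ℝ, ℝ) (𝓡 m) c t (1 : ℝ)

/-- The covariant derivative at time `t` of a vector field `V` along a curve `c`, in the
trivialization of `TM` given by the chart at `c t`: if `V = ∑ vⁱ eᵢ` with `eᵢ` the coordinate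
frame, it is `∑ (vⁱ)' eᵢ + vⁱ D_{c'} eᵢ`. -/
def covDerivAlong (D : Connection m M) (c : ℝ → M) (V : ∀ t, TangentSpace (𝓡 m) (c t)) (t : ℝ) :
    TangentSpace (𝓡 m) (c t) :=
  let e := trivializationAt (Model m) (TangentSpace (𝓡 m) : M → Type _) (c t)
  e.symm (c t) (deriv (fun s => (e ⟨c s, V s⟩).2) t) +
    D (FiberBundle.extend (Model m) (V t)) (c t) (velocity c t)

/-- A geodesic defined on the whole real line. -/
def IsGeodesic (D : Connection m M) (c : ℝ → M) : Prop :=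
  ContMDiff 𝓘(ℝ, ℝ) (𝓡 m) ∞ c ∧ ∀ t, covDerivAlong D c (velocity c) t = 0

/-- `(M, D)` is (geodesically) complete: every tangent vector is the initial velocity of a geodesic
defined on the whole real line. -/
def IsComplete (D : Connection m M) : Prop :=
  ∀ p : TangentBundle (𝓡 m) M, ∃ c : ℝ → M, IsGeodesic D c ∧
    (⟨c 0, velocity c 0⟩ : TangentBundle (𝓡 m) M) = p

theorem differentiableAt_of_section {Y : ∀ x : Model m, TangentSpace (𝓡 m) x} {x : Model m}
    (hY : MDifferentiableAt (𝓡 m) ((𝓡 m).prod 𝓘(ℝ, Model m))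
      (fun y => (⟨y, Y y⟩ : TangentBundle (𝓡 m) (Model m))) x) :
    DifferentiableAt ℝ (F := Model m) Y x := by
  have h := ((contMDiff_snd_tangentBundle_modelSpace (n := 1) (Model m)
    (𝓡 m)).contMDiffAt.mdifferentiableAt one_ne_zero).comp x hY
  exact h.differentiableAt

/-- The standard flat connection of `ℝᵐ`: `D_u Y` is the directional derivative of `Y`. -/
def stdConnection (m : ℕ) : Connection m (Model m) where
  toFun Y x := fderiv ℝ (F := Model m) Y x
  isCovariantDerivativeOnUniv :=
    { add := by
        intro Y Y' x hY hY' _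
        exact fderiv_add (differentiableAt_of_section hY) (differentiableAt_of_section hY')
      leibniz := by
        intro Y g x hY hg _
        have h := fderiv_smul hg.differentiableAt (differentiableAt_of_section hY)
        rw [← mfderiv_eq_fderiv (f := g)] at h
        exact h }

end Basic

section Covering

variable {m : ℕ} {M N : Type*} [TopologicalSpace M] [ChartedSpace (Model m) M]
  [IsManifold (𝓡 m) ∞ M] [TopologicalSpace N] [ChartedSpace (Model m) N]
  [IsManifold (𝓡 m) ∞ N]

/-- `f : (N, D') → (M, D)` is an affine local diffeomorphism: a smooth local diffeomorphism with
`D' = f^* D`, i.e. `df (D'_u Y) = D_{df u} Y'` whenever the vector fields `Y` and `Y'`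
are `f`-related near the point considered. -/
structure IsAffineLocalDiffeo (D' : Connection m N) (D : Connection m M) (f : N → M) : Prop where
  localDiffeo : IsLocalDiffeomorph (𝓡 m) (𝓡 m) ∞ f
  related : ∀ (x : N) (Y : ∀ z : N, TangentSpace (𝓡 m) z) (Y' : ∀ y : M, TangentSpace (𝓡 m) y),
    MDifferentiableAt (𝓡 m) ((𝓡 m).prod 𝓘(ℝ, Model m))
      (fun y => (⟨y, Y' y⟩ : TangentBundle (𝓡 m) M)) (f x) →
    (∀ᶠ z in nhds x, mfderiv (𝓡 m) (𝓡 m) f z (Y z) = Y' (f z)) →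
    ∀ u : TangentSpace (𝓡 m) x,
      mfderiv (𝓡 m) (𝓡 m) f x (D' Y x u) = D Y' (f x) (mfderiv (𝓡 m) (𝓡 m) f x u)

/-- `p : (M̃, D̃) → (M, D)` is the universal covering of the affine manifold `(M, D)`. -/
structure IsUniversalCovering (D' : Connection m N) (D : Connection m M) (p : N → M) : Prop where
  simplyConnected : SimplyConnectedSpace N
  covering : IsCoveringMap p
  surjective : Function.Surjective p
  affine : IsAffineLocalDiffeo D' D p

/-- A developing map: an affine local diffeomorphism from the universal covering to `ℝᵐ`. -/
def IsDevelopingMap (D' : Connection m N) (dev : N → Model m) : Prop :=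
  IsAffineLocalDiffeo D' (stdConnection m) dev

/-- The linear holonomy `ℓ(Γ)` with respect to the developing map `dev`: the linear parts `L` of
the affine transformations `y ↦ L y + b` of `ℝᵐ` with `dev ∘ γ = L (dev ·) + b`, where `γ` runs
through the group of deck transformations of `p`. -/
def linearHolonomy (p : N → M) (dev : N → Model m) : Set (Model m →ₗ[ℝ] Model m) :=
  {L | ∃ γ : N ≃ₜ N, (∀ x, p (γ x) = p x) ∧ ∃ b : Model m, ∀ x, dev (γ x) = L (dev x) + b}

/-- The linear holonomy is contained in the special linear group. -/
def HasUnimodularHolonomy (D' : Connection m N) (p : N → M) : Prop :=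
  ∀ dev : N → Model m, IsDevelopingMap D' dev → ∀ L ∈ linearHolonomy p dev, LinearMap.det L = 1

end Covering

end FlatManifold

end

/-! The cohomological part is the argument that makes the volume form of a star-shaped domain exact.
On a simply connected locally flat manifold there is a developing map `g` to `ℝᵐ`, and pulling back
the radial field of `ℝᵐ` along the local diffeomorphism `g` gives a vector field `E` with `D_a E =
a` for every `a` (`exists_radial_field`, `covD_radial_field`). Pulling back the determinant gives a
parallel volume form.

Let `v` be a parallel form of degree `m` and let the right action be zero, as here. Parallelism says
`av = 0` for the action on cochains, so every summand of `δv` vanishes. By the product rule the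
contraction `w = v(E, …)` satisfies `(aw)(b) = v(D_a E, b) = v(a, b)`. For `m ≥ 2` the coboundary
`δw` has `m - 1` summands; moving `a_j` back to its place produces a sign opposite to the one in
`δ`, so each summand is `-v` and `δw = -(m - 1) v`. For `m = 1`, `w` is a function, it is a Jacobi
element, and `δ(-w) = v`.

The bulk of the file constructs `g`. A function is affine when its Hessian for the connection
vanishes; in a chart its 1-jet `(G, ξ)` then solves the total differential equation `dG = ξ`, `dξ(u)
= ξ ∘ Γ(u)`. Vanishing torsion and curvature are exactly what gives the integrability of this system
(`affineSystem_flat`). It is solved by integrating along rays from a point, with Gronwall's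
inequality proving differentiability in the end point (`exists_totalODE_solution`). Uniqueness shows
that two local solutions with invertible differential differ by an affine automorphism of `ℝᵐ`.
These automorphisms form a locally constant cocycle, which on a simply connected space is a
coboundary because the associated covering has a section
(`exists_trivialization_of_locallyConstant_cocycle`); correcting the local solutions by this
coboundary makes them agree (`exists_developing`). -/

open scoped ContDiff

/-! ### Frobenius theorem for linear total differential equations -/

section TotalLinearODE

open Set Metric Filter Topology
open scoped NNReal

set_option maxSynthPendingDepth 3

variable {E V : Type*} [NormedAddCommGroup E] [NormedSpace ℝ E]
  [NormedAddCommGroup V] [NormedSpace ℝ V]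

/-- A linear ODE on `[0, 1]` whose coefficient has norm at most `1/2` has a solution with any given
initial value. -/
theorem exists_linearODE_solution [CompleteSpace V] (P : ℝ → V →L[ℝ] V)
    (hP : ContinuousOn P (Icc 0 1)) (hb : ∀ t ∈ Icc (0 : ℝ) 1, ‖P t‖ ≤ 1 / 2) (v : V) :
    ∃ α : ℝ → V, α 0 = v ∧
      ∀ t ∈ Icc (0 : ℝ) 1, HasDerivWithinAt α (P t (α t)) (Icc 0 1) t := by
  -- On the closed ball of radius `‖v‖` around `v` one has `‖x‖ ≤ 2‖v‖`, so the bound `1/2` makes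
  -- the speed at most `‖v‖`: the solution cannot leave the ball in unit time.
  have h : IsPicardLindelof (fun t => P t) (⟨0, by simp⟩ : Icc (0 : ℝ) 1) v ‖v‖₊ 0 ‖v‖₊ 1 :=
    { lipschitzOnWith := fun t ht => by
        refine ((P t).lipschitz.weaken ?_).lipschitzOnWith
        rw [← NNReal.coe_le_coe]
        exact (hb t ht).trans (by norm_num)
      continuousOn := fun x _ => hP.clm_apply continuousOn_const
      norm_le := fun t ht x hx => by
        have h1 : ‖x‖ ≤ 2 * ‖v‖ := by
          have := norm_le_norm_add_norm_sub' x v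
          rw [mem_closedBall, dist_eq_norm, coe_nnnorm] at hx
          linarith
        calc ‖P t x‖ ≤ ‖P t‖ * ‖x‖ := (P t).le_opNorm x
          _ ≤ 1 / 2 * (2 * ‖v‖) := by gcongr; exact hb t ht
          _ = ‖v‖ := by ring
      mul_max_le := by simp }
  exact h.exists_eq_forall_mem_Icc_hasDerivWithinAt₀

/-- Second order Taylor estimate for a map with Lipschitz derivative. -/
theorem norm_sub_sub_fderiv_le {A : E → V} {c : E} {r B : ℝ} (hB : 0 ≤ B)
    (hd : ∀ z ∈ ball c r, DifferentiableAt ℝ A z)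
    (hC : ∀ z ∈ ball c r, ∀ w ∈ ball c r, ‖fderiv ℝ A z - fderiv ℝ A w‖ ≤ B * ‖z - w‖)
    {y k : E} (hy : y ∈ ball c r) (hk : y + k ∈ ball c r) :
    ‖A (y + k) - A y - fderiv ℝ A y k‖ ≤ B * ‖k‖ ^ 2 := by
  have hseg : segment ℝ y (y + k) ⊆ ball c r := (convex_ball c r).segment_subset hy hk
  have := (convex_segment (𝕜 := ℝ) y (y + k)).norm_image_sub_le_of_norm_fderiv_le' (f := A)
    (φ := fderiv ℝ A y) (C := B * ‖k‖) (fun z hz => hd z (hseg hz)) (fun z hz => ?_)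
    (left_mem_segment ℝ _ _) (right_mem_segment ℝ _ _)
  · simpa [pow_two, mul_assoc] using this
  · refine (hC z (hseg hz) y hy).trans ?_
    gcongr
    have := norm_sub_le_of_mem_segment hz
    simpa using this

set_option maxHeartbeats 1000000 in
/-- The radial solution of a flat total linear differential equation varies with its end point
according to the equation, up to a quadratic error. -/
theorem norm_radial_sub_le {A : E → E →L[ℝ] V →L[ℝ] V} {c : E} {r B : ℝ} (hB : 1 ≤ B)
    (hr : r ≤ 1 / (2 * B))
    (hd : ∀ z ∈ ball c r, DifferentiableAt ℝ A z)
    (hA : ∀ z ∈ ball c r, ‖A z‖ ≤ B) (hA' : ∀ z ∈ ball c r, ‖fderiv ℝ A z‖ ≤ B)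
    (hC : ∀ z ∈ ball c r, ∀ w ∈ ball c r, ‖fderiv ℝ A z - fderiv ℝ A w‖ ≤ B * ‖z - w‖)
    (hflat : ∀ z ∈ ball c r, ∀ u v w, fderiv ℝ A z u v w + A z v (A z u w) =
      fderiv ℝ A z v u w + A z u (A z v w))
    {x h : E} (hx : c + x ∈ ball c r) (hxh : c + (x + h) ∈ ball c r) {α β : ℝ → V} (h0 : α 0 = β 0)
    (hα : ∀ t ∈ Icc (0 : ℝ) 1, HasDerivWithinAt α (A (c + t • x) x (α t)) (Icc 0 1) t)
    (hβ : ∀ t ∈ Icc (0 : ℝ) 1,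
      HasDerivWithinAt β (A (c + t • (x + h)) (x + h) (β t)) (Icc 0 1) t)
    {R : ℝ} (hR : ∀ t ∈ Icc (0 : ℝ) 1, ‖α t‖ ≤ R) :
    ‖β 1 - α 1 - A (c + x) h (α 1)‖ ≤ 6 * B ^ 2 * R * Real.exp 1 * ‖h‖ ^ 2 := by
  have hB0 : 0 < B := by linarith
  have hr1 : r ≤ 1 / 2 := hr.trans (by
    apply one_div_le_one_div_of_le (by norm_num); linarith)
  have hrB : r * B ≤ 1 / 2 := by
    calc r * B ≤ 1 / (2 * B) * B := by gcongr
      _ = 1 / 2 := by field_simp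
  have key : ∀ y, c + y ∈ ball c r → ‖y‖ < r := by
    intro y hy
    simpa using hy
  have hmem : ∀ y, c + y ∈ ball c r → ∀ t ∈ Icc (0 : ℝ) 1, c + t • y ∈ ball c r := by
    intro y hy t ht
    have := key y hy
    simp only [mem_ball, dist_self_add_left, norm_smul, Real.norm_eq_abs, abs_of_nonneg ht.1]
    nlinarith [norm_nonneg y, ht.2]
  have hR0 : 0 ≤ R := (norm_nonneg _).trans (hR 0 (by simp))
  have nx := key x hx
  have nxh := key _ hxh
  have nh : ‖h‖ ≤ 1 := by
    have : h = (x + h) - x := by abel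
    rw [this]
    exact (norm_sub_le _ _).trans (by linarith)
  -- `γ` is the first order guess for `β`: it starts at the same value and at time `1` equals `α 1 +
  -- A (c + x) h (α 1)`. It is shown to satisfy the equation of `β` up to an error quadratic in `h`,
  -- and Gronwall's inequality compares the two.
  let γ : ℝ → V := fun t => α t + t • A (c + t • x) h (α t)
  let γ' : ℝ → V := fun t => A (c + t • x) x (α t) +
    ((1 : ℝ) • A (c + t • x) h (α t) + t • (fderiv ℝ A (c + t • x) x h (α t) +
      A (c + t • x) h (A (c + t • x) x (α t))))
  have hγ : ∀ t ∈ Icc (0 : ℝ) 1, HasDerivWithinAt γ (γ' t) (Icc 0 1) t := by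
    intro t ht
    have e1 : HasDerivAt (fun s : ℝ => c + s • x) x t := by
      simpa using ((hasDerivAt_id t).smul_const x).const_add c
    have e2 : HasDerivAt (fun s : ℝ => A (c + s • x)) (fderiv ℝ A (c + t • x) x) t :=
      HasFDerivAt.comp_hasDerivAt (l := A) t (hd _ (hmem x hx t ht)).hasFDerivAt e1
    have e3 : HasDerivAt (fun s : ℝ => A (c + s • x) h) (fderiv ℝ A (c + t • x) x h) t := by
      simpa using e2.clm_apply (hasDerivAt_const t h)
    have e4 := e3.hasDerivWithinAt (s := Icc 0 1) |>.clm_apply (hα t ht)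
    have e5 := (hα t ht).add ((hasDerivWithinAt_id t (Icc 0 1)).smul e4)
    refine e5.congr_deriv ?_
    simp only [γ', id]
    abel
  -- The Gronwall lemma is applied with a Lipschitz bound at all times, hence the extension by zero
  -- outside `[0, 1]`. Inside, `r ≤ 1 / (2B)` gives Lipschitz constant at most `1`.
  let f : ℝ → V → V := fun t => if t ∈ Icc (0 : ℝ) 1 then A (c + t • (x + h)) (x + h) else 0
  have hf : ∀ t ∈ Icc (0 : ℝ) 1, f t = A (c + t • (x + h)) (x + h) := fun t ht => if_pos ht
  have hIco : ∀ t, t ∈ Ico (0 : ℝ) 1 → t ∈ Icc (0 : ℝ) 1 := fun t ht => ⟨ht.1, ht.2.le⟩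
  have hder : ∀ {g : ℝ → V} {g' : ℝ → V},
      (∀ t ∈ Icc (0 : ℝ) 1, HasDerivWithinAt g (g' t) (Icc 0 1) t) →
      ∀ t ∈ Ico (0 : ℝ) 1, HasDerivWithinAt g (g' t) (Ici t) t := by
    intro g g' hg t ht
    refine (hg t (hIco t ht)).mono_of_mem_nhdsWithin ?_
    exact mem_of_superset (Icc_mem_nhdsGE ht.2) (Icc_subset_Icc_left ht.1)
  have hlip : ∀ t, LipschitzWith 1 (f t) := by
    intro t
    by_cases ht : t ∈ Icc (0 : ℝ) 1
    · rw [hf t ht]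
      refine (ContinuousLinearMap.lipschitz _).weaken ?_
      rw [← NNReal.coe_le_coe]
      calc ‖A (c + t • (x + h)) (x + h)‖ ≤ ‖A (c + t • (x + h))‖ * ‖x + h‖ :=
            ContinuousLinearMap.le_opNorm _ _
        _ ≤ B * r := by gcongr; exact hA _ (hmem _ hxh t ht)
        _ ≤ 1 := by linarith
    · simp only [f, if_neg ht]
      exact LipschitzWith.const' 0
  -- The error splits into four terms, bounded by `1`, `1`, `1` and `2` times `B² R ‖h‖²`; the
  -- constant `6` leaves slack.
  have hbound : ∀ t ∈ Ico (0 : ℝ) 1, dist (γ' t) (f t (γ t)) ≤ 6 * B ^ 2 * R * ‖h‖ ^ 2 := by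
    intro t ht'
    have ht := hIco t ht'
    rw [hf t ht, dist_eq_norm]
    have mP := hmem x hx t ht
    have mQ := hmem _ hxh t ht
    set P := A (c + t • x) with hP
    set dP := fderiv ℝ A (c + t • x) with hdP
    set Y := α t with hY
    have hQ : c + t • (x + h) = (c + t • x) + t • h := by rw [smul_add]; abel
    have hrem := norm_sub_sub_fderiv_le hB0.le hd hC mP (hQ ▸ mQ)
    rw [← hQ] at hrem
    set Q := A (c + t • (x + h)) with hQdef
    set S := Q - P - dP (t • h) with hS
    have hQS : Q = P + t • dP h + S := by rw [hS, map_smul]; abel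
    have ht1 : |t| ≤ 1 := by rw [abs_of_nonneg ht.1]; exact ht.2
    have hSn : ‖S‖ ≤ B * ‖h‖ ^ 2 := by
      refine hrem.trans ?_
      rw [norm_smul, mul_pow, Real.norm_eq_abs]
      have : |t| ^ 2 ≤ 1 := pow_le_one₀ (abs_nonneg t) ht1
      have h2 := mul_le_mul_of_nonneg_right this (sq_nonneg ‖h‖)
      nlinarith
    have hfl := hflat _ mP h x Y
    rw [← hP, ← hdP] at hfl
    -- Expanding `Q = P + t dP h + S`, all terms of order zero and one in `h` cancel, the first
    -- order ones by flatness at the directions `h` and `x`.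
    have hdiff : γ' t - Q (x + h) (γ t) =
        -(t • P h (P h Y) + t • dP h h Y + t • t • dP h (x + h) (P h Y) + S (x + h) (γ t)) := by
      have hγt : γ t = Y + t • P h Y := rfl
      have hγt' : γ' t = P x Y + ((1 : ℝ) • P h Y + t • (dP x h Y + P h (P x Y))) := rfl
      rw [hQS, hγt', hγt]
      simp only [add_apply, smul_apply, map_add, map_smul, one_smul]
      have : t • (dP x h Y + P h (P x Y)) = t • dP h x Y + t • P x (P h Y) := by
        rw [← smul_add, hfl]
      rw [this]
      simp only [smul_add]
      abel
    rw [hdiff, norm_neg]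
    have nP : ‖P‖ ≤ B := hA _ mP
    have ndP : ‖dP‖ ≤ B := hA' _ mP
    have nY : ‖Y‖ ≤ R := hR t ht
    have nPh : ∀ w, ‖P h w‖ ≤ B * ‖h‖ * ‖w‖ := fun w => by
      refine (P.le_opNorm₂ h w).trans ?_
      gcongr
    have ndPh : ∀ k w, ‖dP h k w‖ ≤ B * ‖h‖ * ‖k‖ * ‖w‖ := fun k w => by
      refine ((dP h).le_opNorm₂ k w).trans ?_
      gcongr
      refine (dP.le_opNorm h).trans ?_
      gcongr
    have nxh1 : ‖x + h‖ ≤ 1 := by linarith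
    have hts : ∀ w : V, ‖t • w‖ ≤ ‖w‖ := fun w => by
      rw [norm_smul, Real.norm_eq_abs]
      exact mul_le_of_le_one_left (norm_nonneg _) ht1
    have b1 : ‖t • P h (P h Y)‖ ≤ B ^ 2 * R * ‖h‖ ^ 2 := by
      refine (hts _).trans ((nPh _).trans ?_)
      calc B * ‖h‖ * ‖P h Y‖ ≤ B * ‖h‖ * (B * ‖h‖ * R) := by
            gcongr
            exact (nPh Y).trans (by gcongr)
        _ = _ := by ring
    have b2 : ‖t • dP h h Y‖ ≤ B ^ 2 * R * ‖h‖ ^ 2 := by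
      refine (hts _).trans ((ndPh _ _).trans ?_)
      calc B * ‖h‖ * ‖h‖ * ‖Y‖ ≤ B * ‖h‖ * ‖h‖ * R := by gcongr
        _ = B * (R * ‖h‖ ^ 2) := by ring
        _ ≤ B ^ 2 * (R * ‖h‖ ^ 2) := by gcongr; nlinarith
        _ = _ := by ring
    have b3 : ‖t • t • dP h (x + h) (P h Y)‖ ≤ B ^ 2 * R * ‖h‖ ^ 2 := by
      refine (hts _).trans ((hts _).trans ((ndPh _ _).trans ?_))
      calc B * ‖h‖ * ‖x + h‖ * ‖P h Y‖ ≤ B * ‖h‖ * 1 * (B * ‖h‖ * R) := by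
            gcongr
            exact (nPh Y).trans (by gcongr)
        _ = _ := by ring
    have nγ : ‖γ t‖ ≤ 2 * B * R := by
      have hγt : γ t = Y + t • P h Y := rfl
      rw [hγt]
      refine (norm_add_le _ _).trans ?_
      have : ‖t • P h Y‖ ≤ B * 1 * R := (hts _).trans ((nPh Y).trans (by gcongr))
      nlinarith
    have b4 : ‖S (x + h) (γ t)‖ ≤ 2 * B ^ 2 * R * ‖h‖ ^ 2 := by
      refine (S.le_opNorm₂ _ _).trans ?_
      calc ‖S‖ * ‖x + h‖ * ‖γ t‖ ≤ (B * ‖h‖ ^ 2) * 1 * (2 * B * R) := by gcongr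
        _ = _ := by ring
    have : 0 ≤ B ^ 2 * R * ‖h‖ ^ 2 := by positivity
    have h1 := norm_add_le (t • P h (P h Y) + t • dP h h Y + t • t • dP h (x + h) (P h Y))
      (S (x + h) (γ t))
    have h2 := norm_add_le (t • P h (P h Y) + t • dP h h Y) (t • t • dP h (x + h) (P h Y))
    have h3 := norm_add_le (t • P h (P h Y)) (t • dP h h Y)
    linarith
  have hβf : ∀ t ∈ Icc (0 : ℝ) 1, HasDerivWithinAt β (f t (β t)) (Icc 0 1) t := by
    intro t ht
    rw [hf t ht]
    exact hβ t ht
  have main := dist_le_of_approx_trajectories_ODE hlip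
    (fun t ht => (hβf t ht).continuousWithinAt) (hder hβf) (εf := 0) (by simp)
    (fun t ht => (hγ t ht).continuousWithinAt) (hder hγ) hbound
    (δ := 0) (by simp [γ, h0]) 1 (by simp)
  rw [dist_eq_norm, gronwallBound_of_K_ne_0 (by simp)] at main
  have e : β 1 - γ 1 = β 1 - α 1 - A (c + x) h (α 1) := by simp [γ]; abel
  rw [e] at main
  refine main.trans ?_
  have hpos : 0 ≤ 6 * B ^ 2 * R * ‖h‖ ^ 2 := by positivity
  simp only [NNReal.coe_one, zero_mul, zero_add, div_one, sub_zero, mul_one]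
  nlinarith

/-- A flat total linear differential equation `dF = A F` has local solutions. -/
theorem exists_totalODE_solution [CompleteSpace V] {A : E → E →L[ℝ] V →L[ℝ] V} {c : E}
    (hA : ContDiffAt ℝ 2 A c)
    (hflat : ∀ᶠ z in 𝓝 c, ∀ u v w, fderiv ℝ A z u v w + A z v (A z u w) =
      fderiv ℝ A z v u w + A z u (A z v w)) (v₀ : V) :
    ∃ F : E → V, F c = v₀ ∧ ∀ᶠ z in 𝓝 c, HasFDerivAt F ((A z).flip (F z)) z := by
  have hA1 : ContDiffAt ℝ 1 (fderiv ℝ A) c := hA.fderiv_right (by norm_num)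
  obtain ⟨K, s, hs, hK⟩ := hA1.exists_lipschitzOnWith
  have b1 : ∀ᶠ z in 𝓝 c, ‖A z‖ < ‖A c‖ + 1 :=
    hA.continuousAt.norm.eventually (gt_mem_nhds (lt_add_one _))
  have b2 : ∀ᶠ z in 𝓝 c, ‖fderiv ℝ A z‖ < ‖fderiv ℝ A c‖ + 1 :=
    hA1.continuousAt.norm.eventually (gt_mem_nhds (lt_add_one _))
  have b3 : ∀ᶠ z in 𝓝 c, DifferentiableAt ℝ A z :=
    (hA.eventually (by simp)).mono fun z hz => hz.differentiableAt (by simp)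
  obtain ⟨r₀, hr₀, H⟩ := Metric.eventually_nhds_iff_ball.1
    ((b1.and b2).and ((b3.and hflat).and hs))
  -- A single constant dominating `A`, its derivative and the Lipschitz constant of the derivative
  -- near `c`; the summand `1` ensures `1 ≤ B`.
  set B : ℝ := 1 + ‖A c‖ + ‖fderiv ℝ A c‖ + K with hBdef
  have hB : 1 ≤ B := by
    have := norm_nonneg (A c); have := norm_nonneg (fderiv ℝ A c); have := K.2
    simp only [hBdef]; linarith
  set r := min r₀ (1 / (2 * B)) with hrdef
  have hr : r ≤ 1 / (2 * B) := min_le_right _ _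
  have hr0 : 0 < r := lt_min hr₀ (by positivity)
  have sub : ball c r ⊆ ball c r₀ := ball_subset_ball (min_le_left _ _)
  have hd : ∀ z ∈ ball c r, DifferentiableAt ℝ A z := fun z hz => (H z (sub hz)).2.1.1
  have hAb : ∀ z ∈ ball c r, ‖A z‖ ≤ B := fun z hz => by
    have := (H z (sub hz)).1.1; have := norm_nonneg (fderiv ℝ A c); have := K.2
    simp only [hBdef]; linarith
  have hA'b : ∀ z ∈ ball c r, ‖fderiv ℝ A z‖ ≤ B := fun z hz => by
    have := (H z (sub hz)).1.2; have := norm_nonneg (A c); have := K.2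
    simp only [hBdef]; linarith
  have hC : ∀ z ∈ ball c r, ∀ w ∈ ball c r,
      ‖fderiv ℝ A z - fderiv ℝ A w‖ ≤ B * ‖z - w‖ := fun z hz w hw => by
    have h1 := hK.dist_le_mul z (H z (sub hz)).2.2 w (H w (sub hw)).2.2
    rw [dist_eq_norm, dist_eq_norm] at h1
    refine h1.trans ?_
    gcongr
    have := norm_nonneg (A c); have := norm_nonneg (fderiv ℝ A c)
    simp only [hBdef]; linarith
  have hfl : ∀ z ∈ ball c r, ∀ u v w, fderiv ℝ A z u v w + A z v (A z u w) =
      fderiv ℝ A z v u w + A z u (A z v w) := fun z hz => (H z (sub hz)).2.1.2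
  have hrB : B * r ≤ 1 / 2 := by
    calc B * r ≤ B * (1 / (2 * B)) := by gcongr
      _ = 1 / 2 := by field_simp
  have hseg : ∀ y, c + y ∈ ball c r → ∀ t ∈ Icc (0 : ℝ) 1, c + t • y ∈ ball c r := by
    intro y hy t ht
    have : ‖y‖ < r := by simpa using hy
    simp only [mem_ball, dist_self_add_left, norm_smul, Real.norm_eq_abs, abs_of_nonneg ht.1]
    nlinarith [norm_nonneg y, ht.2]
  have hex : ∀ y : E, ∃ α : ℝ → V, c + y ∈ ball c r → α 0 = v₀ ∧
      ∀ t ∈ Icc (0 : ℝ) 1, HasDerivWithinAt α (A (c + t • y) y (α t)) (Icc 0 1) t := by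
    intro y
    by_cases hy : c + y ∈ ball c r
    · have hyr : ‖y‖ < r := by simpa using hy
      obtain ⟨α, h1, h2⟩ := exists_linearODE_solution (fun t => A (c + t • y) y)
        (fun t ht => by
          have h1 : ContinuousAt (fun t : ℝ => c + t • y) t := by fun_prop
          have h2 : ContinuousAt (fun t : ℝ => A (c + t • y)) t :=
            ContinuousAt.comp (f := fun t : ℝ => c + t • y) (g := A)
              (hd _ (hseg y hy t ht)).continuousAt h1
          exact (h2.clm_apply continuousAt_const).continuousWithinAt)
        (fun t ht => ((A _).le_opNorm y).trans (by
          refine le_trans ?_ hrB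
          gcongr
          exact hAb _ (hseg y hy t ht))) v₀
      exact ⟨α, fun _ => ⟨h1, h2⟩⟩
    · exact ⟨0, fun h => absurd h hy⟩
  choose α hα using hex
  -- The value at `z` is the time-one value of the solution along the ray from `c` to `z`. At `z =
  -- c` the equation along the ray is `α' = 0`.
  refine ⟨fun z => α (z - c) 1, ?_, ?_⟩
  · have h0 := hα 0 (by simpa using hr0)
    have hderiv : ∀ t ∈ Icc (0 : ℝ) 1, HasDerivWithinAt (α 0) 0 (Icc 0 1) t := by
      intro t ht
      simpa using h0.2 t ht
    have := constant_of_has_deriv_right_zero (a := (0 : ℝ)) (b := 1) (f := α 0)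
      (fun t ht => (hderiv t ht).continuousWithinAt) (fun t ht => by
        refine (hderiv t ⟨ht.1, ht.2.le⟩).mono_of_mem_nhdsWithin ?_
        exact mem_of_superset (Icc_mem_nhdsGE ht.2) (Icc_subset_Icc_left ht.1)) 1 (by simp)
    simp [this, h0.1]
  · filter_upwards [isOpen_ball.mem_nhds (mem_ball_self hr0)] with z hz
    obtain ⟨x, rfl⟩ : ∃ x, z = c + x := ⟨z - c, by abel⟩
    have hαx := hα x hz
    obtain ⟨R, hR⟩ : ∃ R, ∀ t ∈ Icc (0 : ℝ) 1, ‖α x t‖ ≤ R :=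
      isCompact_Icc.exists_bound_of_continuousOn
        (fun t ht => (hαx.2 t ht).continuousWithinAt)
    rw [hasFDerivAt_iff_isLittleO_nhds_zero]
    have hO : (fun h : E => α (c + x + h - c) 1 - α (c + x - c) 1 -
        ((A (c + x)).flip (α (c + x - c) 1)) h) =O[𝓝 0] fun h : E => ‖h‖ ^ 2 := by
      refine Asymptotics.IsBigO.of_bound (6 * B ^ 2 * R * Real.exp 1) ?_
      have hev : ∀ᶠ h in 𝓝 (0 : E), c + (x + h) ∈ ball c r := by
        have hc : ContinuousAt (fun h : E => c + (x + h)) 0 := by fun_prop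
        refine hc.eventually (isOpen_ball.mem_nhds ?_)
        simpa using hz
      filter_upwards [hev] with h hh
      have := norm_radial_sub_le hB hr hd hAb hA'b hC hfl hz hh
        (hαx.1.trans (hα _ hh).1.symm) hαx.2 (hα _ hh).2 hR
      have e1 : c + x + h - c = x + h := by abel
      have e2 : c + x - c = x := by abel
      rw [e1, e2]
      simpa using this
    refine hO.trans_isLittleO ?_
    have := Asymptotics.isLittleO_norm_pow_id (E' := E) (n := 2) (by norm_num)
    exact this

/-- A solution of a total linear differential equation vanishing at a point vanishes near it. -/
theorem totalODE_eventually_eq_zero {A : E → E →L[ℝ] V →L[ℝ] V} {c : E} (hA : ContinuousAt A c)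
    {F : E → V} (hF : ∀ᶠ z in 𝓝 c, HasFDerivAt F ((A z).flip (F z)) z) (h0 : F c = 0) :
    ∀ᶠ z in 𝓝 c, F z = 0 := by
  have b1 : ∀ᶠ z in 𝓝 c, ‖A z‖ < ‖A c‖ + 1 :=
    hA.norm.eventually (gt_mem_nhds (lt_add_one _))
  obtain ⟨r, hr, H⟩ := Metric.eventually_nhds_iff_ball.1 (b1.and hF)
  filter_upwards [isOpen_ball.mem_nhds (mem_ball_self hr)] with z hz
  have hseg : ∀ t ∈ Icc (0 : ℝ) 1, c + t • (z - c) ∈ ball c r := by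
    intro t ht
    have : ‖z - c‖ < r := by simpa [dist_eq_norm] using hz
    simp only [mem_ball, dist_self_add_left, norm_smul, Real.norm_eq_abs, abs_of_nonneg ht.1]
    nlinarith [norm_nonneg (z - c), ht.2]
  have hder : ∀ t ∈ Icc (0 : ℝ) 1, HasDerivAt (fun t : ℝ => F (c + t • (z - c)))
      (A (c + t • (z - c)) (z - c) (F (c + t • (z - c)))) t := by
    intro t ht
    have e1 : HasDerivAt (fun s : ℝ => c + s • (z - c)) (z - c) t := by
      simpa using ((hasDerivAt_id t).smul_const (z - c)).const_add c
    exact (H _ (hseg t ht)).2.comp_hasDerivAt t e1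
  -- Along the segment from `c` to `z`, the restriction of `F` solves a linear ODE with bounded
  -- coefficient and zero initial value.
  have := eq_zero_of_abs_deriv_le_mul_abs_self_of_eq_zero_right
    (K := (‖A c‖ + 1) * ‖z - c‖) (a := (0 : ℝ)) (b := 1)
    (fun t ht => (hder t ht).continuousAt.continuousWithinAt)
    (fun t ht => (hder t ⟨ht.1, ht.2.le⟩).hasDerivWithinAt) (by simp [h0])
    (fun t ht => ((A _).le_opNorm₂ _ _).trans (by
      gcongr
      exact (H _ (hseg t ⟨ht.1, ht.2.le⟩)).1.le)) 1 (by simp)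
  simpa using this

/-- Solutions of a smooth total linear differential equation are smooth. -/
theorem totalODE_contDiffOn {A : E → E →L[ℝ] V →L[ℝ] V} {s : Set E} (hs : IsOpen s)
    (hA : ContDiffOn ℝ ∞ A s) {F : E → V} (hF : ∀ z ∈ s, HasFDerivAt F ((A z).flip (F z)) z) :
    ContDiffOn ℝ ∞ F s := by
  rw [contDiffOn_infty]
  intro n
  induction n with
  | zero =>
    rw [Nat.cast_zero, contDiffOn_zero]
    exact fun z hz => (hF z hz).continuousAt.continuousWithinAt
  | succ n ih =>
    rw [Nat.cast_add, Nat.cast_one, contDiffOn_succ_iff_fderiv_of_isOpen hs]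
    refine ⟨fun z hz => (hF z hz).differentiableAt.differentiableWithinAt, by simp, ?_⟩
    -- Bootstrap: the derivative of `F` is a bilinear expression in `A` and `F`, so it is as smooth
    -- as `F` is already known to be.
    have h1 : ContDiffOn ℝ n (fun z => (A z).flip (F z)) s := by
      have : ContDiffOn ℝ n (fun z => ContinuousLinearMap.flipₗᵢ ℝ E V V (A z)) s :=
        (ContinuousLinearMap.flipₗᵢ ℝ E V V).contDiff.comp_contDiffOn
          (hA.of_le (by norm_cast; exact le_top))
      exact this.clm_apply ih
    exact h1.congr fun z hz => (hF z hz).fderiv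

end TotalLinearODE

/-! ### Triviality of locally constant cocycles on simply connected spaces -/

section LocallyConstantCocycle

open Topology Filter

/-- On a simply connected, locally path connected space, every locally constant `G`-valued
cocycle is a coboundary of locally constant functions. -/
theorem exists_trivialization_of_locallyConstant_cocycle {X G : Type*} [TopologicalSpace X]
    [SimplyConnectedSpace X] [LocallyPathConnectedSpace X] [Group G]
    (U : X → Set X) (hU : ∀ i, IsOpen (U i)) (hmem : ∀ x, x ∈ U x) (τ : X → X → X → G)
    (hτ : ∀ i j k, ∀ x ∈ U i ∩ U j ∩ U k, τ i j x * τ j k x = τ i k x)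
    (hloc : ∀ i j, ∀ x ∈ U i ∩ U j, ∀ᶠ y in 𝓝 x, τ i j y = τ i j x) :
    ∃ s : X → X → G, (∀ i, ∀ x ∈ U i, ∀ᶠ y in 𝓝 x, s i y = s i x) ∧
      ∀ i j, ∀ x ∈ U i ∩ U j, s j x = s i x * τ i j x := by
  -- With the discrete topology on `G`, the bundle glued from the cocycle by right multiplication is
  -- a covering space.
  let _ : TopologicalSpace G := ⊥
  have : DiscreteTopology G := ⟨rfl⟩
  have hone : ∀ i, ∀ x ∈ U i, τ i i x = 1 := fun i x hx => by
    have := hτ i i i x ⟨⟨hx, hx⟩, hx⟩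
    simpa using this
  let Z : FiberBundleCore X X G :=
    { baseSet := U
      isOpen_baseSet := hU
      indexAt := id
      mem_baseSet_at := hmem
      coordChange := fun i j x v => v * τ i j x
      coordChange_self := fun i x hx v => by rw [hone i x hx, mul_one]
      continuousOn_coordChange := fun i j => by
        rintro ⟨x, v⟩ ⟨hx, -⟩
        refine ContinuousAt.continuousWithinAt ?_
        refine (continuousAt_const (y := v * τ i j x)).congr ?_
        have h1 : ∀ᶠ q : X × G in 𝓝 (x, v), τ i j q.1 = τ i j x :=
          (continuousAt_fst (p := (x, v))).eventually (hloc i j x hx)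
        have h2 : ∀ᶠ q : X × G in 𝓝 (x, v), q.2 = v :=
          (continuousAt_snd (p := (x, v))).eventually (p := fun w => w = v) (by simp [nhds_discrete])
        filter_upwards [h1, h2] with q e1 e2
        rw [e1, e2]
      coordChange_comp := fun i j k x hx v => by
        rw [mul_assoc, hτ i j k x hx] }
  have cov : IsCoveringMap (Bundle.TotalSpace.proj : Bundle.TotalSpace G Z.Fiber → X) :=
    FiberBundle.isCoveringMap
  obtain ⟨x₀⟩ : Nonempty X := inferInstance
  -- Simple connectedness lifts the identity map to a global section. Its coordinates in the local
  -- trivializations are the required functions: continuity into a discrete space is local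
  -- constancy.
  obtain ⟨F, ⟨-, hF⟩, -⟩ := cov.existsUnique_continuousMap_lifts (ContinuousMap.id X) x₀
    (⟨x₀, (1 : G)⟩ : Bundle.TotalSpace G Z.Fiber) rfl
  have hproj : ∀ x, (F x).proj = x := fun x => congrFun hF x
  refine ⟨fun i x => (Z.localTriv i (F x)).2, ?_, ?_⟩
  · intro i x hx
    have hc : ContinuousAt (fun y => (Z.localTriv i (F y)).2) x := by
      refine continuousAt_snd.comp (ContinuousAt.comp (f := F) ?_ F.continuous.continuousAt)
      refine (Z.localTriv i).continuousAt ?_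
      rw [Bundle.Trivialization.mem_source]
      change (F x).proj ∈ U i
      rwa [hproj]
    exact hc.eventually (p := fun w => w = (Z.localTriv i (F x)).2) (by simp [nhds_discrete])
  · intro i j x hx
    let w : G := (F x).2
    -- The fibre over `x` is coordinatized by the index `x` itself, so the coordinate in `U i` is `w
    -- * τ x i x`.
    change w * τ (F x).proj j (F x).proj = w * τ (F x).proj i (F x).proj * τ i j x
    rw [mul_assoc, hproj, hτ x i j x ⟨⟨hmem x, hx.1⟩, hx.2⟩]

end LocallyConstantCocycle

noncomputable section

namespace FlatManifold

open Filter Topology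

set_option maxSynthPendingDepth 3

/-! ### Coordinate fields and coordinate functions near a point -/

section Chart

variable {m : ℕ} {M : Type*} [TopologicalSpace M] [ChartedSpace (Model m) M]
  [IsManifold (𝓡 m) ∞ M]

/-- The differential at `y` of the chart around `x₀`. -/
abbrev dChart (x₀ y : M) : TangentSpace (𝓡 m) y →L[ℝ] Model m :=
  mvfderiv (𝓡 m) (extChartAt (𝓡 m) x₀) y

/-- The constant vector field on `ℝᵐ`. -/
def constField (v : Model m) : ∀ x : Model m, TangentSpace (𝓡 m) x := fun _ => v

theorem dChart_isInvertible {x₀ y : M} (hy : y ∈ (chartAt (Model m) x₀).source) :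
    (mfderiv (𝓡 m) (𝓡 m) (extChartAt (𝓡 m) x₀) y).IsInvertible :=
  isInvertible_mfderiv_extChartAt (I := 𝓡 m) (by simpa using hy)

theorem dChart_injective {x₀ y : M} (hy : y ∈ (chartAt (Model m) x₀).source) :
    Function.Injective (dChart (m := m) x₀ y) := by
  obtain ⟨e, he⟩ := dChart_isInvertible (m := m) hy
  intro u v huv
  have h : mfderiv (𝓡 m) (𝓡 m) (extChartAt (𝓡 m) x₀) y u =
    mfderiv (𝓡 m) (𝓡 m) (extChartAt (𝓡 m) x₀) y v := huv
  rw [← he] at h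
  exact e.injective h

theorem dChart_bijective {x₀ y : M} (hy : y ∈ (chartAt (Model m) x₀).source) :
    Function.Bijective (dChart (m := m) x₀ y) := by
  obtain ⟨e, he⟩ := dChart_isInvertible (m := m) hy
  refine ⟨dChart_injective hy, fun w => ⟨e.symm w, ?_⟩⟩
  change mfderiv (𝓡 m) (𝓡 m) (extChartAt (𝓡 m) x₀) y (e.symm w) = w
  rw [← he]
  exact e.apply_symm_apply w

/-- Over the chart domain the trivialization of the tangent bundle at `x₀` is `dChart x₀`, so
smoothness of a section is smoothness of its coordinate representation. -/
theorem contMDiffAt_dChart {x₀ y : M} (hy : y ∈ (chartAt (Model m) x₀).source)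
    {b : ∀ z : M, TangentSpace (𝓡 m) z}
    (hb : ContMDiffAt (𝓡 m) ((𝓡 m).prod 𝓘(ℝ, Model m)) ∞
      (fun z => (⟨z, b z⟩ : TangentBundle (𝓡 m) M)) y) :
    ContMDiffAt (𝓡 m) 𝓘(ℝ, Model m) ∞ (fun z => dChart x₀ z (b z)) y := by
  have hy' : y ∈ (trivializationAt (Model m) (TangentSpace (𝓡 m) : M → Type _) x₀).baseSet := hy
  have h := ((trivializationAt (Model m) (TangentSpace (𝓡 m) : M → Type _)
    x₀).contMDiffAt_section_iff hy').1 hb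
  refine h.congr_of_eventuallyEq ?_
  filter_upwards [(chartAt (Model m) x₀).open_source.mem_nhds hy] with z hz
  have := TangentBundle.continuousLinearMapAt_trivializationAt (I := 𝓡 m) hz
  have h2 := congr($this (b z))
  rw [Bundle.Trivialization.continuousLinearMapAt_apply_of_mem (R := ℝ) (trivializationAt (Model m) (TangentSpace (𝓡 m) : M → Type _) x₀) hz] at h2
  exact h2.symm

variable {F' : Type*} [NormedAddCommGroup F'] [NormedSpace ℝ F']

theorem mvfderiv_eq_fderiv_chart {x₀ y : M} (hy : y ∈ (chartAt (Model m) x₀).source) {f : M → F'}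
    (hf : MDifferentiableAt (𝓡 m) 𝓘(ℝ, F') f y) (u : TangentSpace (𝓡 m) y) :
    mvfderiv (𝓡 m) f y u =
      fderiv ℝ (f ∘ (extChartAt (𝓡 m) x₀).symm) (extChartAt (𝓡 m) x₀ y) (dChart x₀ y u) := by
  have hy' : y ∈ (extChartAt (𝓡 m) x₀).source := by simpa using hy
  have h1 : MDifferentiableAt (𝓡 m) (𝓡 m) (extChartAt (𝓡 m) x₀).symm (extChartAt (𝓡 m) x₀ y) :=
    ((contMDiffOn_extChartAt_symm (n := 1) x₀).contMDiffAt ((isOpen_extChartAt_target x₀).mem_nhds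
      ((extChartAt (𝓡 m) x₀).map_source hy'))).mdifferentiableAt one_ne_zero
  have h2 : MDifferentiableAt (𝓡 m) 𝓘(ℝ, F') (f ∘ (extChartAt (𝓡 m) x₀).symm)
      (extChartAt (𝓡 m) x₀ y) :=
    MDifferentiableAt.comp _ (by rwa [(extChartAt (𝓡 m) x₀).left_inv hy']) h1
  have h3 : f =ᶠ[𝓝 y] (f ∘ (extChartAt (𝓡 m) x₀).symm) ∘ extChartAt (𝓡 m) x₀ := by
    filter_upwards [(chartAt (Model m) x₀).open_source.mem_nhds hy] with z hz
    simp only [Function.comp_apply]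
    rw [(extChartAt (𝓡 m) x₀).left_inv (by simpa using hz)]
  have h4 := mfderiv_comp_apply y h2 (mdifferentiableAt_extChartAt (I := 𝓡 m) hy) u
  change mfderiv (𝓡 m) 𝓘(ℝ, F') f y u = _
  rw [h3.mfderiv_eq, ← mfderiv_eq_fderiv]
  exact h4

theorem contDiffAt_comp_chart_symm {x₀ y : M} (hy : y ∈ (chartAt (Model m) x₀).source) {f : M → F'}
    {n : WithTop ℕ∞} (hn : n ≤ ∞) (hf : ContMDiffAt (𝓡 m) 𝓘(ℝ, F') n f y) :
    ContDiffAt ℝ n (f ∘ (extChartAt (𝓡 m) x₀).symm) (extChartAt (𝓡 m) x₀ y) := by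
  have : IsManifold (𝓡 m) n M := IsManifold.of_le hn
  rw [← contMDiffAt_iff_contDiffAt]
  have hy' : y ∈ (extChartAt (𝓡 m) x₀).source := by simpa using hy
  refine ContMDiffAt.comp (I' := 𝓡 m) _ ?_ ?_
  · rwa [(extChartAt (𝓡 m) x₀).left_inv hy']
  · exact (contMDiffOn_extChartAt_symm x₀).contMDiffAt
      ((isOpen_extChartAt_target x₀).mem_nhds ((extChartAt (𝓡 m) x₀).map_source hy'))

theorem contMDiffAt_comp_chart {x₀ y : M} (hy : y ∈ (chartAt (Model m) x₀).source)
    {G : Model m → F'} {n : WithTop ℕ∞} (hn : n ≤ ∞)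
    (hG : ContDiffAt ℝ n G (extChartAt (𝓡 m) x₀ y)) :
    ContMDiffAt (𝓡 m) 𝓘(ℝ, F') n (G ∘ extChartAt (𝓡 m) x₀) y := by
  have : IsManifold (𝓡 m) n M := IsManifold.of_le hn
  exact ContMDiffAt.comp (I' := 𝓡 m) y hG.contMDiffAt (contMDiffAt_extChartAt' hy)

/-- Global vector fields and functions which near `x₀` are the coordinate fields and the coordinate
functions of the chart around `x₀`. -/
structure Coordinates (x₀ : M) where
  /-- the neighbourhood -/
  dom : Set M
  isOpen_dom : IsOpen dom
  mem_dom : x₀ ∈ dom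
  dom_subset : dom ⊆ (chartAt (Model m) x₀).source
  /-- the coordinate fields -/
  field : Fin m → VField m M
  dChart_field : ∀ y ∈ dom, ∀ i, dChart x₀ y (field i y) = EuclideanSpace.single i 1
  /-- the coordinate functions -/
  coord : Fin m → SmoothFun m M
  coord_eq : ∀ y ∈ dom, ∀ i, coord i y = extChartAt (𝓡 m) x₀ y i

/-- Flatness is formulated with global vector fields, so the coordinate fields and functions are
multiplied by a bump function that is `1` near `x₀`; the Hausdorff property makes the cut-off
objects globally smooth. -/
theorem nonempty_coordinates [T2Space M] (x₀ : M) : Nonempty (Coordinates (m := m) x₀) := by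
  obtain ⟨χ⟩ : Nonempty (SmoothBumpFunction (𝓡 m) x₀) := inferInstance
  obtain ⟨W, hW, hWo, hW0⟩ := eventually_nhds_iff.1 (χ.eventuallyEq_one.and
    ((chartAt (Model m) x₀).open_source.mem_nhds (mem_chart_source _ x₀)))
  have hpull : ∀ (i : Fin m), ContMDiffOn (𝓡 m) ((𝓡 m).prod 𝓘(ℝ, Model m)) ∞
      (fun y => (⟨y, VectorField.mpullback (𝓡 m) (𝓡 m) (extChartAt (𝓡 m) x₀)
        (constField (EuclideanSpace.single i 1)) y⟩ : TangentBundle (𝓡 m) M))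
      (chartAt (Model m) x₀).source := by
    intro i y hy
    refine (ContMDiffAt.mpullback_vectorField_preimage (n := ∞) ?_
      (contMDiffAt_extChartAt' hy) (dChart_isInvertible hy) (by simp)).contMDiffWithinAt
    exact contMDiffAt_vectorSpace_iff_contDiffAt.2 contDiffAt_const
  refine ⟨{ dom := W, isOpen_dom := hWo, mem_dom := hW0, dom_subset := fun y hy => (hW y hy).2
            field := fun i => ⟨fun y => χ y • VectorField.mpullback (𝓡 m) (𝓡 m)
              (extChartAt (𝓡 m) x₀) (constField (EuclideanSpace.single i 1)) y, ?_⟩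
            dChart_field := fun y hy i => ?_
            coord := fun i => ⟨fun y => χ y • extChartAt (𝓡 m) x₀ y i, ?_⟩
            coord_eq := fun y hy i => ?_ }⟩
  · refine ContMDiffOn.smul_section_of_tsupport χ.contMDiff.contMDiffOn
      (chartAt (Model m) x₀).open_source χ.tsupport_subset_chartAt_source (hpull i)
  · obtain ⟨e, he⟩ := dChart_isInvertible (hW y hy).2
    change mfderiv (𝓡 m) (𝓡 m) (extChartAt (𝓡 m) x₀) y (χ y • VectorField.mpullback (𝓡 m) (𝓡 m)
      (extChartAt (𝓡 m) x₀) (constField (EuclideanSpace.single i 1)) y) = _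
    rw [(hW y hy).1, Pi.one_apply, one_smul, VectorField.mpullback_apply, ← he,
      ContinuousLinearMap.inverse_equiv]
    exact e.apply_symm_apply (constField (EuclideanSpace.single i 1) (extChartAt (𝓡 m) x₀ y))
  · refine χ.contMDiff_smul (g := fun y => extChartAt (𝓡 m) x₀ y i) ?_
    intro y hy
    have h1 := (contMDiffAt_extChartAt' (I := 𝓡 m) (n := ∞) hy)
    have h2 : ContDiff ℝ ∞ (fun z : Model m => z i) := by fun_prop
    exact (h2.contMDiff.contMDiffAt.comp y h1).contMDiffWithinAt
  · change χ y • extChartAt (𝓡 m) x₀ y i = _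
    rw [(hW y hy).1, Pi.one_apply, one_smul]

theorem covariantDerivative_sum_smul (D : Connection m M) {ι : Type*} (s : Finset ι)
    (f : ι → M → ℝ) (σ : ι → ∀ y : M, TangentSpace (𝓡 m) y) {x : M}
    (hf : ∀ i ∈ s, MDifferentiableAt (𝓡 m) 𝓘(ℝ, ℝ) (f i) x)
    (hσ : ∀ i ∈ s, MDifferentiableAt (𝓡 m) ((𝓡 m).prod 𝓘(ℝ, Model m))
      (fun y => (⟨y, σ i y⟩ : TangentBundle (𝓡 m) M)) x) (u : TangentSpace (𝓡 m) x) :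
    D (fun y => ∑ i ∈ s, f i y • σ i y) x u =
      ∑ i ∈ s, (f i x • D (σ i) x u + mvfderiv (𝓡 m) (f i) x u • σ i x) := by
  classical
  induction s using Finset.induction_on with
  | empty =>
    have := D.isCovariantDerivativeOnUniv.zero (x := x)
    simp only [Finset.sum_empty]
    exact congr($this u)
  | insert i s hi ih =>
    simp only [Finset.sum_insert hi]
    have h1 := hf i (by simp)
    have h2 := hσ i (by simp)
    have h3 : MDifferentiableAt (𝓡 m) ((𝓡 m).prod 𝓘(ℝ, Model m))
        (fun y => (⟨y, ∑ i ∈ s, f i y • σ i y⟩ : TangentBundle (𝓡 m) M)) x :=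
      MDifferentiableAt.sum_section fun j hj => (hf j (by simp [hj])).smul_section (hσ j (by simp [hj]))
    have h4 := D.isCovariantDerivativeOnUniv.add (h1.smul_section h2) h3
    have h5 := D.isCovariantDerivativeOnUniv.leibniz h2 h1
    rw [h5] at h4
    rw [← ih (fun j hj => hf j (by simp [hj])) (fun j hj => hσ j (by simp [hj]))]
    exact congr($h4 u)

end Chart

/-! ### The connection in coordinates -/

section Christoffel

variable {m : ℕ} {M : Type*} [TopologicalSpace M] [ChartedSpace (Model m) M]
  [IsManifold (𝓡 m) ∞ M]

variable (D : Connection m M) (hs : CovariantDerivative.ContMDiffCovariantDerivative D ∞)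

namespace Coordinates

variable {D} {x₀ : M} (C : Coordinates (m := m) x₀)

/-- The vector field with constant coefficients `v` in the coordinates near `x₀`. -/
def const (v : Model m) : VField m M := ∑ i, v i • C.field i

theorem const_apply (v : Model m) (y : M) : C.const v y = ∑ i, v i • C.field i y := by
  have : ∀ s : Finset (Fin m), (∑ i ∈ s, v i • C.field i : VField m M) y =
      ∑ i ∈ s, v i • C.field i y := by
    intro s
    induction s using Finset.cons_induction with
    | empty => rfl
    | cons i s hi ih =>
      rw [Finset.sum_cons, Finset.sum_cons, ← ih]
      rfl
  exact this _

theorem dChart_const {y : M} (hy : y ∈ C.dom) (v : Model m) : dChart x₀ y (C.const v y) = v := by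
  rw [const_apply, map_sum]
  simp only [map_smul, C.dChart_field y hy]
  ext j
  simp [Finset.sum_apply, Pi.single_apply]

theorem eq_const {y : M} (hy : y ∈ C.dom) (u : TangentSpace (𝓡 m) y) :
    u = C.const (dChart x₀ y u) y :=
  dChart_injective (C.dom_subset hy) (C.dChart_const hy _).symm

theorem mvfderiv_dChart_const {y : M} (hy : y ∈ C.dom) (v : Model m)
    (u : TangentSpace (𝓡 m) y) :
    mvfderiv (𝓡 m) (fun z => dChart x₀ z (C.const v z)) y u = 0 := by
  have h : (fun z => dChart x₀ z (C.const v z)) =ᶠ[𝓝 y] fun _ => v := by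
    filter_upwards [C.isOpen_dom.mem_nhds hy] with z hz using C.dChart_const hz v
  have h2 := h.mfderiv_eq (I := 𝓡 m) (I' := 𝓘(ℝ, Model m))
  have h3 : mvfderiv (𝓡 m) (fun _ : M => v) y = 0 := mvfderiv_const v
  change mfderiv (𝓡 m) 𝓘(ℝ, Model m) _ y u = 0
  rw [h2]
  exact congr($h3 u)

/-- The components of `D_{∂ᵢ} ∂ⱼ` as functions on the chart target. -/
def christoffelComp (i j : Fin m) (z : Model m) : Model m :=
  dChart x₀ ((extChartAt (𝓡 m) x₀).symm z)
    (covD D hs (C.field i) (C.field j) ((extChartAt (𝓡 m) x₀).symm z))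

/-- The Christoffel tensor of the connection in the chart around `x₀`. -/
def christoffel (z : Model m) : Model m →L[ℝ] Model m →L[ℝ] Model m :=
  ∑ i, ∑ j, ContinuousLinearMap.smulRight (EuclideanSpace.proj i : Model m →L[ℝ] ℝ)
    (ContinuousLinearMap.smulRight (EuclideanSpace.proj j : Model m →L[ℝ] ℝ)
      (C.christoffelComp hs i j z))

theorem christoffel_apply (z u v : Model m) :
    C.christoffel hs z u v = ∑ i, ∑ j, u i • v j • C.christoffelComp hs i j z := by
  simp [christoffel, sum_apply]

theorem contDiffAt_christoffelComp (i j : Fin m) {y : M} (hy : y ∈ C.dom) :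
    ContDiffAt ℝ ∞ (C.christoffelComp hs i j) (extChartAt (𝓡 m) x₀ y) :=
  contDiffAt_comp_chart_symm (C.dom_subset hy) le_rfl (contMDiffAt_dChart (C.dom_subset hy)
    (covD D hs (C.field i) (C.field j)).contMDiff.contMDiffAt)

theorem contDiffAt_christoffel {y : M} (hy : y ∈ C.dom) :
    ContDiffAt ℝ ∞ (C.christoffel hs) (extChartAt (𝓡 m) x₀ y) := by
  unfold christoffel
  refine ContDiffAt.sum fun i _ => ContDiffAt.sum fun j _ => ?_
  have h1 := (ContinuousLinearMap.smulRightL ℝ (Model m) (Model m)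
    (EuclideanSpace.proj j : Model m →L[ℝ] ℝ)).contDiff.comp_contDiffAt _
    (C.contDiffAt_christoffelComp hs i j hy)
  exact (ContinuousLinearMap.smulRightL ℝ (Model m) (Model m →L[ℝ] Model m)
    (EuclideanSpace.proj i : Model m →L[ℝ] ℝ)).contDiff.comp_contDiffAt _ h1

theorem chart_symm_chart {y : M} (hy : y ∈ C.dom) :
    (extChartAt (𝓡 m) x₀).symm (extChartAt (𝓡 m) x₀ y) = y :=
  (extChartAt (𝓡 m) x₀).left_inv (by simpa using C.dom_subset hy)

theorem christoffelComp_chart (i j : Fin m) {y : M} (hy : y ∈ C.dom) :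
    C.christoffelComp hs i j (extChartAt (𝓡 m) x₀ y) =
      dChart x₀ y (covD D hs (C.field i) (C.field j) y) := by
  rw [christoffelComp, C.chart_symm_chart hy]

/-- `D_a b = a(b) + Γ(a, b)` in coordinates. -/
theorem dChart_covD (a b : VField m M) {y : M} (hy : y ∈ C.dom) :
    dChart x₀ y (covD D hs a b y) = mvfderiv (𝓡 m) (fun z => dChart x₀ z (b z)) y (a y) +
      C.christoffel hs (extChartAt (𝓡 m) x₀ y) (dChart x₀ y (a y)) (dChart x₀ y (b y)) := by
  have hbs : ContMDiffAt (𝓡 m) 𝓘(ℝ, Model m) ∞ (fun z => dChart x₀ z (b z)) y :=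
    contMDiffAt_dChart (C.dom_subset hy) b.contMDiff.contMDiffAt
  have hbd := hbs.mdifferentiableAt (by simp)
  let f : Fin m → M → ℝ := fun i z => dChart x₀ z (b z) i
  have hfd : ∀ i, HasMFDerivAt (𝓡 m) 𝓘(ℝ, ℝ) (f i) y
      ((EuclideanSpace.proj i : Model m →L[ℝ] ℝ).comp
        (mvfderiv (𝓡 m) (fun z => dChart x₀ z (b z)) y)) := fun i =>
    (EuclideanSpace.proj i : Model m →L[ℝ] ℝ).hasFDerivAt.hasMFDerivAt.comp y hbd.hasMFDerivAt
  have hfield : ∀ i, MDifferentiableAt (𝓡 m) ((𝓡 m).prod 𝓘(ℝ, Model m))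
      (fun z => (⟨z, C.field i z⟩ : TangentBundle (𝓡 m) M)) y :=
    fun i => (C.field i).contMDiff.contMDiffAt.mdifferentiableAt (by simp)
  -- A covariant derivative is local, so near `y` the field `b` may be replaced by its expansion in
  -- the coordinate frame and the Leibniz rule applied.
  have h1 : D b y = D (fun z => ∑ i, f i z • C.field i z) y := by
    refine D.isCovariantDerivativeOnUniv.congr_of_eventuallyEq
      (b.contMDiff.contMDiffAt.mdifferentiableAt (by simp))
      (MDifferentiableAt.sum_section fun i _ =>
        (hfd i).mdifferentiableAt.smul_section (hfield i)) Filter.univ_mem ?_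
    filter_upwards [C.isOpen_dom.mem_nhds hy] with z hz
    exact (C.eq_const hz (b z)).trans (C.const_apply _ z)
  have h2 := covariantDerivative_sum_smul D Finset.univ f (fun i => C.field i)
    (fun i _ => (hfd i).mdifferentiableAt) (fun i _ => hfield i) (a y)
  have h3 : ∀ i, D (C.field i) y (a y) =
      ∑ k, dChart x₀ y (a y) k • covD D hs (C.field k) (C.field i) y := by
    intro i
    have : a y = ∑ k, dChart x₀ y (a y) k • C.field k y :=
      (C.eq_const hy (a y)).trans (C.const_apply _ y)
    conv_lhs => rw [this]
    rw [map_sum]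
    simp only [map_smul]
    rfl
  have h4 : covD D hs a b y = D b y (a y) := rfl
  have h5 : ∀ i, mvfderiv (𝓡 m) (f i) y (a y) =
      mvfderiv (𝓡 m) (fun z => dChart x₀ z (b z)) y (a y) i := fun i => by
    have := (hfd i).mfderiv
    exact congr($this (a y))
  rw [h4, h1, h2, Finset.sum_add_distrib, add_comm, map_add]
  congr 1
  · simp only [h5, map_sum, map_smul, C.dChart_field y hy]
    ext j
    simp [Pi.single_apply]
  · rw [christoffel_apply, Finset.sum_comm]
    simp only [h3, map_sum, map_smul, Finset.smul_sum, C.christoffelComp_chart hs _ _ hy]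
    refine Finset.sum_congr rfl fun i _ => Finset.sum_congr rfl fun k _ => ?_
    rw [smul_comm]

end Coordinates

end Christoffel

/-! ### Torsion, curvature and Hessian in coordinates -/

section Curvature

variable {m : ℕ} {M : Type*} [TopologicalSpace M] [ChartedSpace (Model m) M]
  [IsManifold (𝓡 m) ∞ M]

/-- The function `g` satisfies `a(b g) = (D_a b) g` at `y` for all vector fields `a`, `b`. -/
def HessianVanishes {F' : Type*} [NormedAddCommGroup F'] [NormedSpace ℝ F'] (D : Connection m M)
    (hs : CovariantDerivative.ContMDiffCovariantDerivative D ∞) (g : M → F') (y : M) : Prop :=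
  ∀ a b : VField m M, mvfderiv (𝓡 m) (fun z => mvfderiv (𝓡 m) g z (b z)) y (a y) =
    mvfderiv (𝓡 m) g y (covD D hs a b y)

omit [IsManifold (𝓡 m) ∞ M] in
theorem mvfderiv_congr {F' : Type*} [NormedAddCommGroup F'] [NormedSpace ℝ F'] {f g : M → F'}
    {y : M} (h : f =ᶠ[𝓝 y] g) (u : TangentSpace (𝓡 m) y) :
    mvfderiv (𝓡 m) f y u = mvfderiv (𝓡 m) g y u := by
  have h2 := h.mfderiv_eq (I := 𝓡 m) (I' := 𝓘(ℝ, F'))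
  change mfderiv (𝓡 m) 𝓘(ℝ, F') f y u = mfderiv (𝓡 m) 𝓘(ℝ, F') g y u
  rw [h2]
  rfl

omit [IsManifold (𝓡 m) ∞ M] in
theorem mvfderiv_clm_apply {E' F' : Type*} [NormedAddCommGroup E'] [NormedSpace ℝ E']
    [NormedAddCommGroup F'] [NormedSpace ℝ F'] {A : M → E' →L[ℝ] F'} {f : M → E'} {y : M}
    (hA : MDifferentiableAt (𝓡 m) 𝓘(ℝ, E' →L[ℝ] F') A y)
    (hf : MDifferentiableAt (𝓡 m) 𝓘(ℝ, E') f y) (u : TangentSpace (𝓡 m) y) :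
    mvfderiv (𝓡 m) (fun z => A z (f z)) y u =
      A y (mvfderiv (𝓡 m) f y u) + mvfderiv (𝓡 m) A y u (f y) := by
  have h1 := (isBoundedBilinearMap_apply (𝕜 := ℝ) (E := E') (F := F')).hasFDerivAt (A y, f y)
  have hp : HasMFDerivAt (𝓡 m) 𝓘(ℝ, (E' →L[ℝ] F') × E') (fun z => (A z, f z)) y
      ((mvfderiv (𝓡 m) A y).prod (mvfderiv (𝓡 m) f y)) :=
    ⟨hA.hasMFDerivAt.1.prodMk hf.hasMFDerivAt.1, hA.hasMFDerivAt.2.prodMk hf.hasMFDerivAt.2⟩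
  have h2 := HasMFDerivAt.comp (f := fun z => (A z, f z)) y h1.hasMFDerivAt hp
  have h3 := h2.mfderiv
  exact congr($h3 u)

namespace Coordinates

variable {D : Connection m M} {x₀ : M} (C : Coordinates (m := m) x₀)

theorem mvfderiv_comp_chart {F' : Type*} [NormedAddCommGroup F'] [NormedSpace ℝ F']
    {G : Model m → F'} {y : M} (hy : y ∈ C.dom)
    (hG : DifferentiableAt ℝ G (extChartAt (𝓡 m) x₀ y)) (u : TangentSpace (𝓡 m) y) :
    mvfderiv (𝓡 m) (fun z => G (extChartAt (𝓡 m) x₀ z)) y u =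
      fderiv ℝ G (extChartAt (𝓡 m) x₀ y) (dChart x₀ y u) := by
  have h4 := mfderiv_comp_apply (I'' := 𝓘(ℝ, F')) y hG.mdifferentiableAt
    (mdifferentiableAt_extChartAt (I := 𝓡 m) (C.dom_subset hy)) u
  rw [mfderiv_eq_fderiv] at h4
  exact h4

theorem mvfderiv_coord (k : Fin m) {y : M} (hy : y ∈ C.dom) (u : TangentSpace (𝓡 m) y) :
    mvfderiv (𝓡 m) (C.coord k) y u = dChart x₀ y u k := by
  have h : C.coord k =ᶠ[𝓝 y] fun z => (EuclideanSpace.proj k : Model m →L[ℝ] ℝ)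
      (extChartAt (𝓡 m) x₀ z) := by
    filter_upwards [C.isOpen_dom.mem_nhds hy] with z hz using C.coord_eq z hz k
  rw [mvfderiv_congr h, C.mvfderiv_comp_chart hy (ContinuousLinearMap.differentiableAt _),
    ContinuousLinearMap.fderiv]
  rfl

theorem lieD_const_lieD_coord (u v : Model m) (k : Fin m) {y : M} (hy : y ∈ C.dom) :
    lieD (C.const u) (lieD (C.const v) (C.coord k)) y = 0 := by
  have h : (lieD (C.const v) (C.coord k) : M → ℝ) =ᶠ[𝓝 y] fun _ => v k := by
    filter_upwards [C.isOpen_dom.mem_nhds hy] with z hz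
    exact (C.mvfderiv_coord k hz _).trans (by rw [C.dChart_const hz])
  have h3 : mvfderiv (𝓡 m) (fun _ : M => v k) y = 0 := mvfderiv_const _
  exact (mvfderiv_congr h _).trans congr($h3 _)

/-- The left module identity, which encodes vanishing torsion, is tested on the coordinate
functions. Their second derivatives along constant fields vanish, so the two covariant derivatives
have equal components. -/
theorem covD_const_comm (h : IsLocallyFlat D) (u v : Model m) {y : M} (hy : y ∈ C.dom) :
    covD D h.smooth (C.const u) (C.const v) y = covD D h.smooth (C.const v) (C.const u) y := by
  refine dChart_injective (C.dom_subset hy) ?_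
  ext k
  have h1 : lieD (covD D h.smooth (C.const u) (C.const v)) (C.coord k) y -
      lieD (C.const u) (lieD (C.const v) (C.coord k)) y =
      lieD (covD D h.smooth (C.const v) (C.const u)) (C.coord k) y -
      lieD (C.const v) (lieD (C.const u) (C.coord k)) y :=
    congr(($((kvModule D h).assoc_left (C.const u) (C.const v) (C.coord k)) : SmoothFun m M) y)
  rw [C.lieD_const_lieD_coord u v k hy, C.lieD_const_lieD_coord v u k hy, sub_zero, sub_zero] at h1
  have h2 := C.mvfderiv_coord k hy (covD D h.smooth (C.const u) (C.const v) y)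
  have h3 := C.mvfderiv_coord k hy (covD D h.smooth (C.const v) (C.const u) y)
  exact h2.symm.trans (h1.trans h3)

theorem dChart_covD_const (hs : CovariantDerivative.ContMDiffCovariantDerivative D ∞) (u v : Model m) {y : M} (hy : y ∈ C.dom) :
    dChart x₀ y (covD D hs (C.const u) (C.const v) y) =
      C.christoffel hs (extChartAt (𝓡 m) x₀ y) u v := by
  rw [C.dChart_covD hs _ _ hy, C.mvfderiv_dChart_const hy, C.dChart_const hy, C.dChart_const hy,
    zero_add]

theorem christoffel_comm (h : IsLocallyFlat D) (u v : Model m) {y : M} (hy : y ∈ C.dom) :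
    C.christoffel h.smooth (extChartAt (𝓡 m) x₀ y) u v =
      C.christoffel h.smooth (extChartAt (𝓡 m) x₀ y) v u := by
  rw [← C.dChart_covD_const h.smooth u v hy, C.covD_const_comm h u v hy,
    C.dChart_covD_const h.smooth v u hy]

theorem dChart_covD_covD_const (hs : CovariantDerivative.ContMDiffCovariantDerivative D ∞) (u v w : Model m) {y : M} (hy : y ∈ C.dom) :
    dChart x₀ y (covD D hs (C.const u) (covD D hs (C.const v) (C.const w)) y) =
      fderiv ℝ (C.christoffel hs) (extChartAt (𝓡 m) x₀ y) u v w +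
      C.christoffel hs (extChartAt (𝓡 m) x₀ y) u
        (C.christoffel hs (extChartAt (𝓡 m) x₀ y) v w) := by
  rw [C.dChart_covD hs _ _ hy, C.dChart_const hy, C.dChart_covD_const hs v w hy]
  congr 1
  have h : (fun z => dChart x₀ z (covD D hs (C.const v) (C.const w) z)) =ᶠ[𝓝 y]
      fun z => C.christoffel hs (extChartAt (𝓡 m) x₀ z) v w := by
    filter_upwards [C.isOpen_dom.mem_nhds hy] with z hz using C.dChart_covD_const hs v w hz
  have hd := (C.contDiffAt_christoffel hs hy).differentiableAt (by simp)
  have hd2 : HasFDerivAt (fun z => C.christoffel hs z v w) _ (extChartAt (𝓡 m) x₀ y) :=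
    (hd.hasFDerivAt.clm_apply (hasFDerivAt_const v _)).clm_apply (hasFDerivAt_const w _)
  rw [mvfderiv_congr h, C.mvfderiv_comp_chart (G := fun z => C.christoffel hs z v w) hy
    hd2.differentiableAt, hd2.fderiv, C.dChart_const hy]
  simp

/-- This is the left symmetry `(a, b, c) = (b, a, c)` on constant fields: the terms `(ab)c` and
`(ba)c` cancel because constant fields satisfy `ab = ba` on the coordinate domain. -/
theorem christoffel_flat (h : IsLocallyFlat D) (u v w : Model m) {y : M} (hy : y ∈ C.dom) :
    fderiv ℝ (C.christoffel h.smooth) (extChartAt (𝓡 m) x₀ y) u v w +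
      C.christoffel h.smooth (extChartAt (𝓡 m) x₀ y) u
        (C.christoffel h.smooth (extChartAt (𝓡 m) x₀ y) v w) =
    fderiv ℝ (C.christoffel h.smooth) (extChartAt (𝓡 m) x₀ y) v u w +
      C.christoffel h.smooth (extChartAt (𝓡 m) x₀ y) v
        (C.christoffel h.smooth (extChartAt (𝓡 m) x₀ y) u w) := by
  rw [← C.dChart_covD_covD_const h.smooth u v w hy, ← C.dChart_covD_covD_const h.smooth v u w hy]
  congr 1
  have h1 : D (C.const w) y (covD D h.smooth (C.const u) (C.const v) y) -
      covD D h.smooth (C.const u) (covD D h.smooth (C.const v) (C.const w)) y =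
      D (C.const w) y (covD D h.smooth (C.const v) (C.const u) y) -
      covD D h.smooth (C.const v) (covD D h.smooth (C.const u) (C.const w)) y :=
    congr(($((kvAlgebra D h).assoc_comm (C.const u) (C.const v) (C.const w)) : VField m M) y)
  rw [C.covD_const_comm h u v hy] at h1
  exact sub_right_injective h1

/-- The derivative of the components of `b` occurs once in `a(b g)` and once in `(D_a b) g` and
cancels. What remains depends on `a` and `b` only through their values at `y`. -/
theorem hessian_eq {F' : Type*} [NormedAddCommGroup F'] [NormedSpace ℝ F']
    (hs : CovariantDerivative.ContMDiffCovariantDerivative D ∞) {g : M → F'} {y : M}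
    (hy : y ∈ C.dom) (hg : ContMDiffAt (𝓡 m) 𝓘(ℝ, F') ∞ g y) (a b : VField m M) :
    mvfderiv (𝓡 m) (fun z => mvfderiv (𝓡 m) g z (b z)) y (a y) -
      mvfderiv (𝓡 m) g y (covD D hs a b y) =
    fderiv ℝ (fderiv ℝ (g ∘ (extChartAt (𝓡 m) x₀).symm)) (extChartAt (𝓡 m) x₀ y)
        (dChart x₀ y (a y)) (dChart x₀ y (b y)) -
      fderiv ℝ (g ∘ (extChartAt (𝓡 m) x₀).symm) (extChartAt (𝓡 m) x₀ y)
        (C.christoffel hs (extChartAt (𝓡 m) x₀ y) (dChart x₀ y (a y)) (dChart x₀ y (b y))) := by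
  set G := g ∘ (extChartAt (𝓡 m) x₀).symm with hGdef
  have hG : ContDiffAt ℝ 2 G (extChartAt (𝓡 m) x₀ y) :=
    contDiffAt_comp_chart_symm (C.dom_subset hy) (by norm_cast) (hg.of_le (by norm_cast))
  have hG1 : DifferentiableAt ℝ (fderiv ℝ G) (extChartAt (𝓡 m) x₀ y) :=
    (hG.fderiv_right (m := 1) (by norm_num)).differentiableAt one_ne_zero
  have hev : ∀ᶠ z in 𝓝 y, MDifferentiableAt (𝓡 m) 𝓘(ℝ, F') g z :=
    ((contMDiffAt_iff_contMDiffAt_nhds (n := 1) (by simp)).1 (hg.of_le (by simp))).mono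
      fun z hz => hz.mdifferentiableAt one_ne_zero
  have h1 : (fun z => mvfderiv (𝓡 m) g z (b z)) =ᶠ[𝓝 y]
      fun z => fderiv ℝ G (extChartAt (𝓡 m) x₀ z) (dChart x₀ z (b z)) := by
    filter_upwards [C.isOpen_dom.mem_nhds hy, hev] with z hz hgz
    exact mvfderiv_eq_fderiv_chart (C.dom_subset hz) hgz _
  have hbd : MDifferentiableAt (𝓡 m) 𝓘(ℝ, Model m) (fun z => dChart x₀ z (b z)) y :=
    (contMDiffAt_dChart (C.dom_subset hy) b.contMDiff.contMDiffAt).mdifferentiableAt (by simp)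
  have hGm : HasMFDerivAt (𝓡 m) 𝓘(ℝ, Model m →L[ℝ] F')
      (fun z => fderiv ℝ G (extChartAt (𝓡 m) x₀ z)) y
      ((fderiv ℝ (fderiv ℝ G) (extChartAt (𝓡 m) x₀ y)).comp (dChart x₀ y)) :=
    hG1.hasFDerivAt.hasMFDerivAt.comp y
      (mdifferentiableAt_extChartAt (I := 𝓡 m) (C.dom_subset hy)).hasMFDerivAt
  have h2 : mvfderiv (𝓡 m) (fun z => fderiv ℝ G (extChartAt (𝓡 m) x₀ z) (dChart x₀ z (b z))) y (a y)
      = fderiv ℝ (fderiv ℝ G) (extChartAt (𝓡 m) x₀ y) (dChart x₀ y (a y)) (dChart x₀ y (b y)) +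
        fderiv ℝ G (extChartAt (𝓡 m) x₀ y)
          (mvfderiv (𝓡 m) (fun z => dChart x₀ z (b z)) y (a y)) :=
    mvfderiv_clm_apply hGm.mdifferentiableAt hbd (a y) |>.trans (by
      have h3 : mvfderiv (𝓡 m) (fun z => fderiv ℝ G (extChartAt (𝓡 m) x₀ z)) y =
        (fderiv ℝ (fderiv ℝ G) (extChartAt (𝓡 m) x₀ y)).comp (dChart x₀ y) := hGm.mfderiv
      rw [add_comm, h3]
      rfl)
  rw [mvfderiv_congr h1, h2, mvfderiv_eq_fderiv_chart (C.dom_subset hy) hev.self_of_nhds,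
    C.dChart_covD hs a b hy, map_add]
  abel

theorem hessianVanishes_iff {F' : Type*} [NormedAddCommGroup F'] [NormedSpace ℝ F']
    (hs : CovariantDerivative.ContMDiffCovariantDerivative D ∞) {g : M → F'} {y : M}
    (hy : y ∈ C.dom) (hg : ContMDiffAt (𝓡 m) 𝓘(ℝ, F') ∞ g y) :
    HessianVanishes D hs g y ↔ ∀ u v : Model m,
      fderiv ℝ (fderiv ℝ (g ∘ (extChartAt (𝓡 m) x₀).symm)) (extChartAt (𝓡 m) x₀ y) u v =
      fderiv ℝ (g ∘ (extChartAt (𝓡 m) x₀).symm) (extChartAt (𝓡 m) x₀ y)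
        (C.christoffel hs (extChartAt (𝓡 m) x₀ y) u v) := by
  constructor
  · intro H u v
    have := C.hessian_eq hs hy hg (C.const u) (C.const v)
    rwa [H, sub_self, C.dChart_const hy, C.dChart_const hy, eq_comm, sub_eq_zero] at this
  · intro H a b
    have := C.hessian_eq hs hy hg a b
    rwa [H, sub_self, sub_eq_zero] at this

end Coordinates

end Curvature

/-! ### The total differential equation of affine functions -/

section AffineSystem

variable {E F' : Type*} [NormedAddCommGroup E] [NormedSpace ℝ E] [NormedAddCommGroup F']
  [NormedSpace ℝ F']

open ContinuousLinearMap in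
/-- The map `u ↦ ((g, ξ) ↦ (ξ u, 0))`. -/
def affineSystemConst (E F' : Type*) [NormedAddCommGroup E] [NormedSpace ℝ E]
    [NormedAddCommGroup F'] [NormedSpace ℝ F'] :
    E →L[ℝ] (F' × (E →L[ℝ] F')) →L[ℝ] (F' × (E →L[ℝ] F')) :=
  (compL ℝ (F' × (E →L[ℝ] F')) F' (F' × (E →L[ℝ] F')) (inl ℝ F' (E →L[ℝ] F'))).comp
    (((compL ℝ (F' × (E →L[ℝ] F')) (E →L[ℝ] F') F').flip (snd ℝ F' (E →L[ℝ] F'))).comp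
      (apply ℝ F'))

open ContinuousLinearMap in
/-- The map `T ↦ ((g, ξ) ↦ (0, ξ ∘ T))`. -/
def affineSystemComp (E F' : Type*) [NormedAddCommGroup E] [NormedSpace ℝ E]
    [NormedAddCommGroup F'] [NormedSpace ℝ F'] :
    (E →L[ℝ] E) →L[ℝ] (F' × (E →L[ℝ] F')) →L[ℝ] (F' × (E →L[ℝ] F')) :=
  (compL ℝ (F' × (E →L[ℝ] F')) (E →L[ℝ] F') (F' × (E →L[ℝ] F'))
    (inr ℝ F' (E →L[ℝ] F'))).comp
    (((compL ℝ (F' × (E →L[ℝ] F')) (E →L[ℝ] F') (E →L[ℝ] F')).flip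
      (snd ℝ F' (E →L[ℝ] F'))).comp (compL ℝ E E F').flip)

/-- The coefficient of the total linear differential equation `dg = ξ`, `dξ(u) = ξ ∘ Γ(u)` whose
solutions are the affine functions with their differentials. -/
def affineSystem (F' : Type*) [NormedAddCommGroup F'] [NormedSpace ℝ F']
    (Γ : E → E →L[ℝ] E →L[ℝ] E) (z : E) :
    E →L[ℝ] (F' × (E →L[ℝ] F')) →L[ℝ] (F' × (E →L[ℝ] F')) :=
  affineSystemConst E F' + (affineSystemComp E F').comp (Γ z)

theorem affineSystem_apply (Γ : E → E →L[ℝ] E →L[ℝ] E) (z u : E) (w : F' × (E →L[ℝ] F')) :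
    affineSystem F' Γ z u w = (w.2 u, w.2.comp (Γ z u)) := by
  change ((w.2 u, 0) : F' × (E →L[ℝ] F')) + (0, w.2.comp (Γ z u)) = _
  simp

theorem contDiffAt_affineSystem {Γ : E → E →L[ℝ] E →L[ℝ] E} {z : E} {n : WithTop ℕ∞}
    (h : ContDiffAt ℝ n Γ z) : ContDiffAt ℝ n (affineSystem F' Γ) z :=
  contDiffAt_const.add (contDiffAt_const.clm_comp h)

theorem fderiv_affineSystem_apply {Γ : E → E →L[ℝ] E →L[ℝ] E} {z : E}
    (h : DifferentiableAt ℝ Γ z) (u v : E) (w : F' × (E →L[ℝ] F')) :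
    fderiv ℝ (affineSystem F' Γ) z u v w = (0, w.2.comp (fderiv ℝ Γ z u v)) := by
  have h1 : HasFDerivAt (affineSystem F' Γ) _ z :=
    ((hasFDerivAt_const (affineSystemComp E F') z).clm_comp h.hasFDerivAt).const_add
      (affineSystemConst E F')
  rw [h1.fderiv]
  simp
  rfl

/-- The first component of the integrability condition is the symmetry of `Γ`, evaluated under `ξ =
w.2`; the second is `ξ` applied to the curvature identity. -/
theorem affineSystem_flat {Γ : E → E →L[ℝ] E →L[ℝ] E} {z : E}
    (h : DifferentiableAt ℝ Γ z) (htor : ∀ u v, Γ z u v = Γ z v u)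
    (hcurv : ∀ u v w, fderiv ℝ Γ z u v w + Γ z u (Γ z v w) =
      fderiv ℝ Γ z v u w + Γ z v (Γ z u w)) (u v : E) (w : F' × (E →L[ℝ] F')) :
    fderiv ℝ (affineSystem F' Γ) z u v w + affineSystem F' Γ z v (affineSystem F' Γ z u w) =
      fderiv ℝ (affineSystem F' Γ) z v u w + affineSystem F' Γ z u (affineSystem F' Γ z v w) := by
  simp only [fderiv_affineSystem_apply h, affineSystem_apply]
  refine Prod.ext ?_ ?_
  · simp [htor u v]
  · ext x
    have := congrArg w.2 (hcurv u v x)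
    simpa using this

end AffineSystem

/-! ### Local affine functions: existence and uniqueness -/

section LocalDeveloping

variable {m : ℕ} {M : Type*} [TopologicalSpace M] [ChartedSpace (Model m) M]
  [IsManifold (𝓡 m) ∞ M] {D : Connection m M} {x₀ : M}

/-- `g` is smooth and affine at `y`. -/
def IsAffineAt {F' : Type*} [NormedAddCommGroup F'] [NormedSpace ℝ F'] (D : Connection m M)
    (hs : CovariantDerivative.ContMDiffCovariantDerivative D ∞) (g : M → F') (y : M) : Prop :=
  ContMDiffAt (𝓡 m) 𝓘(ℝ, F') ∞ g y ∧ HessianVanishes D hs g y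

namespace Coordinates

variable (C : Coordinates (m := m) x₀)

theorem eventually_chart_symm {P : M → Prop} (hP : ∀ᶠ y in 𝓝 x₀, P y) :
    ∀ᶠ z in 𝓝 (extChartAt (𝓡 m) x₀ x₀), ∃ y ∈ C.dom, extChartAt (𝓡 m) x₀ y = z ∧ P y := by
  have h1 := (continuousAt_extChartAt_symm (I := 𝓡 m) x₀)
  have h2 : ∀ᶠ y in 𝓝 ((extChartAt (𝓡 m) x₀).symm (extChartAt (𝓡 m) x₀ x₀)), y ∈ C.dom ∧ P y := by
    rw [C.chart_symm_chart C.mem_dom]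
    exact Filter.Eventually.and (C.isOpen_dom.mem_nhds C.mem_dom) hP
  filter_upwards [h1.eventually h2, extChartAt_target_mem_nhds (I := 𝓡 m) x₀] with z hz hzt
  exact ⟨_, hz.1, (extChartAt (𝓡 m) x₀).right_inv hzt, hz.2⟩

variable {F' : Type*} [NormedAddCommGroup F'] [NormedSpace ℝ F']

/-- In the chart, vanishing of the Hessian reads `G''(u, v) = G'(Γ(u, v))`, which is the second half
of the affine system; the first half is the definition of the derivative. -/
theorem hasFDerivAt_jet (hs : CovariantDerivative.ContMDiffCovariantDerivative D ∞) {g : M → F'}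
    {y : M} (hy : y ∈ C.dom) (hg : IsAffineAt D hs g y) :
    HasFDerivAt (fun z => ((g ∘ (extChartAt (𝓡 m) x₀).symm) z,
        fderiv ℝ (g ∘ (extChartAt (𝓡 m) x₀).symm) z))
      ((affineSystem F' (C.christoffel hs) (extChartAt (𝓡 m) x₀ y)).flip
        ((g ∘ (extChartAt (𝓡 m) x₀).symm) (extChartAt (𝓡 m) x₀ y),
          fderiv ℝ (g ∘ (extChartAt (𝓡 m) x₀).symm) (extChartAt (𝓡 m) x₀ y)))
      (extChartAt (𝓡 m) x₀ y) := by
  have hG : ContDiffAt ℝ 2 (g ∘ (extChartAt (𝓡 m) x₀).symm) (extChartAt (𝓡 m) x₀ y) :=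
    contDiffAt_comp_chart_symm (C.dom_subset hy) (by norm_cast) (hg.1.of_le (by norm_cast))
  have hG1 : DifferentiableAt ℝ (fderiv ℝ (g ∘ (extChartAt (𝓡 m) x₀).symm))
      (extChartAt (𝓡 m) x₀ y) :=
    (hG.fderiv_right (m := 1) (by norm_num)).differentiableAt one_ne_zero
  have h := (hG.differentiableAt (by simp)).hasFDerivAt.prodMk hG1.hasFDerivAt
  refine h.congr_fderiv ?_
  ext u : 1
  rw [ContinuousLinearMap.flip_apply, affineSystem_apply]
  refine Prod.ext rfl ?_
  ext v
  exact (C.hessianVanishes_iff hs hy hg.1).1 hg.2 u v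

/-- By linearity the difference of the two 1-jets solves the affine system, and it vanishes at `x₀`.
-/
theorem eventuallyEq_of_jet_eq (C : Coordinates (m := m) x₀)
    (hs : CovariantDerivative.ContMDiffCovariantDerivative D ∞)
    {g g' : M → F'} (hg : ∀ᶠ y in 𝓝 x₀, IsAffineAt D hs g y)
    (hg' : ∀ᶠ y in 𝓝 x₀, IsAffineAt D hs g' y) (h0 : g x₀ = g' x₀)
    (h1 : ∀ u, mvfderiv (𝓡 m) g x₀ u = mvfderiv (𝓡 m) g' x₀ u) : g =ᶠ[𝓝 x₀] g' := by
  have hjet : ∀ {f : M → F'}, (∀ᶠ y in 𝓝 x₀, IsAffineAt D hs f y) →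
      ∀ᶠ z in 𝓝 (extChartAt (𝓡 m) x₀ x₀),
        HasFDerivAt (fun z => ((f ∘ (extChartAt (𝓡 m) x₀).symm) z,
            fderiv ℝ (f ∘ (extChartAt (𝓡 m) x₀).symm) z))
          ((affineSystem F' (C.christoffel hs) z).flip
            ((f ∘ (extChartAt (𝓡 m) x₀).symm) z, fderiv ℝ (f ∘ (extChartAt (𝓡 m) x₀).symm) z)) z := by
    intro f hf
    filter_upwards [C.eventually_chart_symm hf] with z hz
    obtain ⟨y, hy, rfl, hfy⟩ := hz
    exact C.hasFDerivAt_jet hs hy hfy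
  have hsub := totalODE_eventually_eq_zero
    (A := affineSystem F' (C.christoffel hs)) (c := extChartAt (𝓡 m) x₀ x₀)
    (contDiffAt_affineSystem (C.contDiffAt_christoffel hs C.mem_dom)).continuousAt
    (F := fun z => ((g ∘ (extChartAt (𝓡 m) x₀).symm) z,
        fderiv ℝ (g ∘ (extChartAt (𝓡 m) x₀).symm) z) -
      ((g' ∘ (extChartAt (𝓡 m) x₀).symm) z, fderiv ℝ (g' ∘ (extChartAt (𝓡 m) x₀).symm) z))
    (by
      filter_upwards [hjet hg, hjet hg'] with z h2 h3
      rw [map_sub]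
      exact h2.sub h3)
    (by
      rw [sub_eq_zero]
      refine Prod.ext ?_ ?_
      · simp only [Function.comp_apply, C.chart_symm_chart C.mem_dom, h0]
      · ext v
        obtain ⟨u, rfl⟩ := (dChart_bijective (C.dom_subset C.mem_dom)).2 v
        have hd := hg.self_of_nhds.1.mdifferentiableAt (by simp)
        have hd' := hg'.self_of_nhds.1.mdifferentiableAt (by simp)
        have := h1 u
        rwa [mvfderiv_eq_fderiv_chart (C.dom_subset C.mem_dom) hd,
          mvfderiv_eq_fderiv_chart (C.dom_subset C.mem_dom) hd'] at this)
  filter_upwards [(continuousAt_extChartAt (I := 𝓡 m) x₀).eventually hsub,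
    C.isOpen_dom.mem_nhds C.mem_dom] with y hy hyd
  have := congrArg Prod.fst (sub_eq_zero.1 hy)
  simpa only [Function.comp_apply, C.chart_symm_chart hyd] using this

/-- The first component of a solution of the affine system has the second component as its
differential, so it is affine; starting from an invertible differential keeps it invertible nearby,
the units being open. -/
theorem exists_local_developing (C : Coordinates (m := m) x₀) (h : IsLocallyFlat D) :
    ∃ g : M → Model m, ∀ᶠ y in 𝓝 x₀, IsAffineAt D h.smooth g y ∧
      Function.Bijective (mvfderiv (𝓡 m) g y) := by
  set Γ := C.christoffel h.smooth with hΓ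
  set A := affineSystem (Model m) Γ with hA
  set c := extChartAt (𝓡 m) x₀ x₀ with hc
  obtain ⟨F, hF0, hF⟩ := exists_totalODE_solution (A := A) (c := c)
    (contDiffAt_affineSystem ((C.contDiffAt_christoffel h.smooth C.mem_dom).of_le (by norm_cast)))
    (by
      filter_upwards [C.eventually_chart_symm (P := fun _ => True) (by simp)] with z hz
      obtain ⟨y, hy, rfl, -⟩ := hz
      exact affineSystem_flat ((C.contDiffAt_christoffel h.smooth hy).differentiableAt (by simp))
        (fun u v => C.christoffel_comm h u v hy) (fun u v w => C.christoffel_flat h u v w hy))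
    -- Prescribed 1-jet at `x₀`: value zero, and the identity as differential in the chart.
    ((0, ContinuousLinearMap.id ℝ (Model m)) : Model m × (Model m →L[ℝ] Model m))
  have hinv : ∀ᶠ z in 𝓝 c, IsUnit (F z).2 := by
    have hcont : ContinuousAt (fun z => (F z).2) c :=
      continuousAt_snd.comp hF.self_of_nhds.continuousAt
    refine hcont.eventually (Units.isOpen.mem_nhds ?_)
    change IsUnit (F c).2
    rw [hF0]
    exact isUnit_one
  have hAs : ∀ᶠ z in 𝓝 c, ContDiffAt ℝ ∞ A z := by
    filter_upwards [C.eventually_chart_symm (P := fun _ => True) (by simp)] with z hz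
    obtain ⟨y, hy, rfl, -⟩ := hz
    exact contDiffAt_affineSystem (C.contDiffAt_christoffel h.smooth hy)
  obtain ⟨s, hs, hso, hsc⟩ := eventually_nhds_iff.1 ((hF.and hAs).and hinv)
  have hFs : ContDiffOn ℝ ∞ F s := totalODE_contDiffOn hso
    (fun z hz => (hs z hz).1.2.contDiffWithinAt) fun z hz => (hs z hz).1.1
  refine ⟨fun y => (F (extChartAt (𝓡 m) x₀ y)).1, ?_⟩
  filter_upwards [(continuousAt_extChartAt (I := 𝓡 m) x₀).eventually (hso.mem_nhds hsc),
    C.isOpen_dom.mem_nhds C.mem_dom] with y hys hy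
  have hys : extChartAt (𝓡 m) x₀ y ∈ s := hys
  have hsm : ContMDiffAt (𝓡 m) 𝓘(ℝ, Model m) ∞ (fun y => (F (extChartAt (𝓡 m) x₀ y)).1) y :=
    contMDiffAt_comp_chart (G := fun z => (F z).1) (C.dom_subset hy) le_rfl
      (contDiff_fst.contDiffAt.comp _ (hFs.contDiffAt (hso.mem_nhds hys)))
  have hd1 : ∀ z ∈ s, HasFDerivAt (fun z => (F z).1) (F z).2 z := fun z hz => by
    refine (hasFDerivAt_fst.comp z (hs z hz).1.1).congr_fderiv ?_
    ext u : 1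
    simp [hA, affineSystem_apply]
  have hd2 : ∀ z ∈ s, ∀ u v, fderiv ℝ (fun z => (F z).2) z u v = (F z).2 (Γ z u v) := by
    intro z hz u v
    have hd : HasFDerivAt (fun z => (F z).2) _ z := hasFDerivAt_snd.comp z (hs z hz).1.1
    rw [hd.fderiv]
    simp [hA, affineSystem_apply]
  have hEq : (fun y => (F (extChartAt (𝓡 m) x₀ y)).1) ∘ (extChartAt (𝓡 m) x₀).symm
      =ᶠ[𝓝 (extChartAt (𝓡 m) x₀ y)] fun z => (F z).1 := by
    filter_upwards [extChartAt_target_mem_nhds' (I := 𝓡 m) ((extChartAt (𝓡 m) x₀).map_source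
      (by simpa using C.dom_subset hy))] with z hz
    simp only [Function.comp_apply, (extChartAt (𝓡 m) x₀).right_inv hz]
  have hfd : fderiv ℝ (fun z => (F z).1) =ᶠ[𝓝 (extChartAt (𝓡 m) x₀ y)] fun z => (F z).2 := by
    filter_upwards [hso.mem_nhds hys] with z hz using (hd1 z hz).fderiv
  refine ⟨⟨hsm, (C.hessianVanishes_iff h.smooth hy hsm).2 fun u v => ?_⟩, ?_⟩
  · rw [hEq.fderiv.fderiv_eq, hfd.fderiv_eq, hEq.fderiv_eq, hfd.self_of_nhds, hd2 _ hys]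
  · have h2 : ∀ u, mvfderiv (𝓡 m) (fun y => (F (extChartAt (𝓡 m) x₀ y)).1) y u =
        (F (extChartAt (𝓡 m) x₀ y)).2 (dChart x₀ y u) := fun u => by
      rw [mvfderiv_eq_fderiv_chart (C.dom_subset hy) (hsm.mdifferentiableAt (by simp)),
        hEq.fderiv_eq, hfd.self_of_nhds]
    have h3 : (mvfderiv (𝓡 m) (fun y => (F (extChartAt (𝓡 m) x₀ y)).1) y :
        TangentSpace (𝓡 m) y → Model m) = (F (extChartAt (𝓡 m) x₀ y)).2 ∘ dChart x₀ y := funext h2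
    rw [h3]
    exact ((ContinuousLinearMap.isUnit_iff_bijective).1 (hs _ hys).2).comp
      (dChart_bijective (C.dom_subset hy))

end Coordinates

end LocalDeveloping

/-! ### Gluing local solutions to a global developing map -/

section Developing

variable {m : ℕ} {M : Type*} [TopologicalSpace M] [ChartedSpace (Model m) M]
  [IsManifold (𝓡 m) ∞ M] {D : Connection m M}

section Affine

variable {F' : Type*} [NormedAddCommGroup F'] [NormedSpace ℝ F']

theorem contMDiffAt_mvfderiv_apply {g : M → F'} {y : M} (hg : ContMDiffAt (𝓡 m) 𝓘(ℝ, F') ∞ g y)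
    (b : VField m M) :
    ContMDiffAt (𝓡 m) 𝓘(ℝ, F') ∞ (fun z => mvfderiv (𝓡 m) g z (b z)) y := by
  have hy := mem_chart_source (Model m) y
  have hev : ∀ᶠ z in 𝓝 y, MDifferentiableAt (𝓡 m) 𝓘(ℝ, F') g z :=
    ((contMDiffAt_iff_contMDiffAt_nhds (n := 1) (by simp)).1 (hg.of_le (by simp))).mono
      fun z hz => hz.mdifferentiableAt one_ne_zero
  have hG : ContDiffAt ℝ ∞ (fderiv ℝ (g ∘ (extChartAt (𝓡 m) y).symm)) (extChartAt (𝓡 m) y y) :=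
    (contDiffAt_comp_chart_symm hy le_rfl hg).fderiv_right (m := ∞) (by simp)
  refine ((contMDiffAt_comp_chart hy le_rfl hG).clm_apply
    (contMDiffAt_dChart hy b.contMDiff.contMDiffAt)).congr_of_eventuallyEq ?_
  filter_upwards [(chartAt (Model m) y).open_source.mem_nhds hy, hev] with z hz hgz
  exact mvfderiv_eq_fderiv_chart hz hgz _

theorem IsAffineAt.congr {hs : CovariantDerivative.ContMDiffCovariantDerivative D ∞}
    {f g : M → F'} {y : M} (hg : IsAffineAt D hs g y) (h : f =ᶠ[𝓝 y] g) :
    IsAffineAt D hs f y := by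
  refine ⟨hg.1.congr_of_eventuallyEq h, fun a b => ?_⟩
  have h1 : (fun z => mvfderiv (𝓡 m) f z (b z)) =ᶠ[𝓝 y] fun z => mvfderiv (𝓡 m) g z (b z) := by
    filter_upwards [h.eventuallyEq_nhds] with z hz using mvfderiv_congr hz _
  rw [mvfderiv_congr h1, mvfderiv_congr h, hg.2 a b]

omit [IsManifold (𝓡 m) ∞ M] in
theorem mvfderiv_clm_add_const {F'' : Type*} [NormedAddCommGroup F''] [NormedSpace ℝ F'']
    (L : F' →L[ℝ] F'') (c : F'') {g : M → F'} {y : M}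
    (hg : MDifferentiableAt (𝓡 m) 𝓘(ℝ, F') g y) (u : TangentSpace (𝓡 m) y) :
    mvfderiv (𝓡 m) (fun z => L (g z) + c) y u = L (mvfderiv (𝓡 m) g y u) := by
  have h1 : HasFDerivAt (fun w => L w + c) L (g y) := L.hasFDerivAt.add_const c
  have h2 := (HasMFDerivAt.comp y h1.hasMFDerivAt hg.hasMFDerivAt).mfderiv
  exact congr($h2 u)

theorem IsAffineAt.clm_add_const {F'' : Type*} [NormedAddCommGroup F''] [NormedSpace ℝ F'']
    {hs : CovariantDerivative.ContMDiffCovariantDerivative D ∞} {g : M → F'} {y : M}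
    (hg : IsAffineAt D hs g y) (L : F' →L[ℝ] F'') (c : F'') :
    IsAffineAt D hs (fun z => L (g z) + c) y := by
  have hev : ∀ᶠ z in 𝓝 y, MDifferentiableAt (𝓡 m) 𝓘(ℝ, F') g z :=
    ((contMDiffAt_iff_contMDiffAt_nhds (n := 1) (by simp)).1 (hg.1.of_le (by simp))).mono
      fun z hz => hz.mdifferentiableAt one_ne_zero
  have hsm : ContDiff ℝ ∞ (fun w => L w + c) := L.contDiff.add contDiff_const
  refine ⟨hsm.contMDiff.contMDiffAt.comp y hg.1, fun a b => ?_⟩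
  have h1 : (fun z => mvfderiv (𝓡 m) (fun z => L (g z) + c) z (b z)) =ᶠ[𝓝 y]
      fun z => L (mvfderiv (𝓡 m) g z (b z)) + 0 := by
    filter_upwards [hev] with z hz
    rw [mvfderiv_clm_add_const L c hz, add_zero]
  rw [mvfderiv_congr h1, mvfderiv_clm_add_const L c hev.self_of_nhds, mvfderiv_clm_add_const L 0
    ((contMDiffAt_mvfderiv_apply hg.1 b).mdifferentiableAt (by simp)), hg.2 a b]

end Affine

/-- The differential of `g` at `y`, in terms of the model space. -/
def modelDeriv (g : M → Model m) (y : M) : Model m →ₗ[ℝ] Model m :=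
  (mvfderiv (𝓡 m) g y).toLinearMap

open Classical in
/-- The 1-jet `u ↦ g y + dg_y u` of `g` at `y` as an affine automorphism of `ℝᵐ`. -/
def affineJet (g : M → Model m) (y : M) : Model m ≃ᵃ[ℝ] Model m :=
  if h : Function.Bijective (modelDeriv g y) then
    (LinearEquiv.ofBijective (modelDeriv g y) h).toAffineEquiv.trans
      (AffineEquiv.constVAdd ℝ (Model m) (g y))
  -- A junk value that makes the transition elements total; the cocycle and local constancy
  -- conditions matter only on overlaps, where the differentials are bijective.
  else 1

omit [IsManifold (𝓡 m) ∞ M] in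
theorem affineJet_apply {g : M → Model m} {y : M}
    (h : Function.Bijective (mvfderiv (𝓡 m) g y)) (u : TangentSpace (𝓡 m) y) :
    affineJet g y u = g y + mvfderiv (𝓡 m) g y u := by
  rw [affineJet, dif_pos (show Function.Bijective (modelDeriv g y) from h)]
  rfl

omit [IsManifold (𝓡 m) ∞ M] in
theorem affineJet_zero {g : M → Model m} {y : M}
    (h : Function.Bijective (mvfderiv (𝓡 m) g y)) : affineJet g y 0 = g y := by
  have := affineJet_apply h 0
  rw [map_zero, add_zero] at this
  exact this

/-- An affine automorphism of `ℝᵐ` is a continuous linear map up to a translation. -/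
theorem affineEquiv_apply (a : Model m ≃ᵃ[ℝ] Model m) (v : Model m) :
    a v = LinearMap.toContinuousLinearMap (a.linear : Model m →ₗ[ℝ] Model m) v + a 0 := by
  have := a.map_vadd 0 v
  simpa using this

theorem IsAffineAt.affineEquiv_comp
    {hs : CovariantDerivative.ContMDiffCovariantDerivative D ∞} {g : M → Model m} {y : M}
    (hg : IsAffineAt D hs g y) (a : Model m ≃ᵃ[ℝ] Model m) :
    IsAffineAt D hs (fun z => a (g z)) y := by
  rw [show (fun z => a (g z)) = _ from funext fun z => affineEquiv_apply a (g z)]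
  exact hg.clm_add_const _ _

omit [IsManifold (𝓡 m) ∞ M] in
theorem mvfderiv_affineEquiv_comp {g : M → Model m} {y : M}
    (hg : MDifferentiableAt (𝓡 m) 𝓘(ℝ, Model m) g y)
    (a : Model m ≃ᵃ[ℝ] Model m) (u : TangentSpace (𝓡 m) y) :
    mvfderiv (𝓡 m) (fun z => a (g z)) y u = a.linear (mvfderiv (𝓡 m) g y u) := by
  rw [show (fun z => a (g z)) = _ from funext fun z => affineEquiv_apply a (g z)]
  exact mvfderiv_clm_add_const _ _ hg u

omit [IsManifold (𝓡 m) ∞ M] in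
theorem bijective_mvfderiv_affineEquiv_comp {g : M → Model m} {y : M}
    (hg : MDifferentiableAt (𝓡 m) 𝓘(ℝ, Model m) g y)
    (h : Function.Bijective (mvfderiv (𝓡 m) g y)) (a : Model m ≃ᵃ[ℝ] Model m) :
    Function.Bijective (mvfderiv (𝓡 m) (fun z => a (g z)) y) := by
  have h3 : (mvfderiv (𝓡 m) (fun z => a (g z)) y : TangentSpace (𝓡 m) y → Model m) =
      a.linear ∘ mvfderiv (𝓡 m) g y := funext fun u => mvfderiv_affineEquiv_comp hg a u
  rw [h3]
  exact a.linear.bijective.comp h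

omit [IsManifold (𝓡 m) ∞ M] in
theorem affineJet_affineEquiv_comp {g : M → Model m} {y : M}
    (hg : MDifferentiableAt (𝓡 m) 𝓘(ℝ, Model m) g y)
    (h : Function.Bijective (mvfderiv (𝓡 m) g y)) (a : Model m ≃ᵃ[ℝ] Model m) :
    affineJet (fun z => a (g z)) y = a * affineJet g y := by
  ext1 u
  have h1 := affineJet_apply (bijective_mvfderiv_affineEquiv_comp hg h a) u
  have h2 := affineJet_apply h u
  change affineJet (fun z => a (g z)) y u = a (affineJet g y u)
  have h3 := a.map_vadd (g y) (mvfderiv (𝓡 m) g y u)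
  rw [vadd_eq_add, vadd_eq_add, add_comm, add_comm (a.linear _)] at h3
  exact h1.trans ((congrArg (a (g y) + ·) (mvfderiv_affineEquiv_comp hg a u)).trans
    (h3.symm.trans (congrArg a h2.symm)))

omit [IsManifold (𝓡 m) ∞ M] in
theorem affineJet_congr {f g : M → Model m} {y : M} (h : f =ᶠ[𝓝 y] g) :
    affineJet f y = affineJet g y := by
  have h1 : modelDeriv f y = modelDeriv g y := by
    ext1 u
    exact mvfderiv_congr h u
  unfold affineJet
  rw [h1, h.self_of_nhds]

/-- Two local developing maps differ by an affine automorphism of `ℝᵐ`. -/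
theorem eventuallyEq_affineEquiv_comp [T2Space M]
    {hs : CovariantDerivative.ContMDiffCovariantDerivative D ∞} {f g : M → Model m} {y : M}
    (hf : ∀ᶠ z in 𝓝 y, IsAffineAt D hs f z) (hg : ∀ᶠ z in 𝓝 y, IsAffineAt D hs g z)
    (hf' : Function.Bijective (mvfderiv (𝓡 m) f y))
    (hg' : Function.Bijective (mvfderiv (𝓡 m) g y)) :
    f =ᶠ[𝓝 y] fun z => (affineJet f y * (affineJet g y)⁻¹) (g z) := by
  obtain ⟨C⟩ := nonempty_coordinates (m := m) y
  -- By equivariance of the jet under affine automorphisms, this is the `a` for which `a ∘ g` and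
  -- `f` have the same 1-jet at `y`; uniqueness then gives equality near `y`.
  set a := affineJet f y * (affineJet g y)⁻¹ with ha
  have hJ : affineJet f y = affineJet (fun z => a (g z)) y := by
    rw [affineJet_affineEquiv_comp (hg.self_of_nhds.1.mdifferentiableAt (by simp)) hg', ha,
      inv_mul_cancel_right]
  have hb := bijective_mvfderiv_affineEquiv_comp
    (hg.self_of_nhds.1.mdifferentiableAt (by simp)) hg' a
  have h0 : f y = a (g y) := by
    rw [← affineJet_zero hf', hJ, affineJet_zero hb]
  refine C.eventuallyEq_of_jet_eq hs hf (hg.mono fun z hz => hz.affineEquiv_comp a) h0 fun u => ?_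
  have h1 := affineJet_apply hf' u
  have h2 := affineJet_apply hb u
  rw [hJ, h2, ← h0] at h1
  exact (add_left_cancel h1).symm

/-- A simply connected locally flat manifold has a developing map. -/
theorem exists_developing [T2Space M] [SimplyConnectedSpace M] (h : IsLocallyFlat D) :
    ∃ g : M → Model m, ∀ y, IsAffineAt D h.smooth g y ∧
      Function.Bijective (mvfderiv (𝓡 m) g y) := by
  have : LocallyPathConnectedSpace M := ChartedSpace.locallyPathConnectedSpace (Model m) M
  have hloc : ∀ x : M, ∃ (g : M → Model m) (U : Set M), IsOpen U ∧ x ∈ U ∧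
      ∀ y ∈ U, IsAffineAt D h.smooth g y ∧ Function.Bijective (mvfderiv (𝓡 m) g y) := by
    intro x
    obtain ⟨C⟩ := nonempty_coordinates (m := m) x
    obtain ⟨g, hg⟩ := C.exists_local_developing h
    obtain ⟨U, h1, h2, h3⟩ := eventually_nhds_iff.1 hg
    exact ⟨g, U, h2, h3, h1⟩
  choose g U hUo hmem hU using hloc
  have hnear : ∀ i, ∀ y ∈ U i, ∀ᶠ z in 𝓝 y, IsAffineAt D h.smooth (g i) z := fun i y hy => by
    filter_upwards [(hUo i).mem_nhds hy] with z hz using (hU i z hz).1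
  have hmd : ∀ i, ∀ y ∈ U i, MDifferentiableAt (𝓡 m) 𝓘(ℝ, Model m) (g i) y := fun i y hy =>
    (hU i y hy).1.1.mdifferentiableAt (by simp)
  -- The transition element is the quotient of the 1-jets. Near a point `g i = a ∘ g j` for a fixed
  -- `a`, and then the quotient is constantly `a`.
  obtain ⟨s, hs, hsτ⟩ := exists_trivialization_of_locallyConstant_cocycle U hUo hmem
    (fun i j y => affineJet (g i) y * (affineJet (g j) y)⁻¹)
    (fun i j k y _ => by rw [mul_assoc, inv_mul_cancel_left])
    (fun i j x hx => by
      have h1 := eventuallyEq_affineEquiv_comp (hnear i x hx.1) (hnear j x hx.2)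
        (hU i x hx.1).2 (hU j x hx.2).2
      filter_upwards [h1.eventuallyEq_nhds, (hUo j).mem_nhds hx.2] with y hy hyU
      rw [affineJet_congr hy, affineJet_affineEquiv_comp (hmd j y hyU) (hU j y hyU).2,
        mul_inv_cancel_right])
  refine ⟨fun y => s y y (g y y), fun x => ?_⟩
  have hEq : (fun y => s y y (g y y)) =ᶠ[𝓝 x] fun y => s x x (g x y) := by
    filter_upwards [hs x x (hmem x), (hUo x).mem_nhds (hmem x)] with y hy hyU
    rw [hsτ x y y ⟨hyU, hmem y⟩, ← hy]
    -- The jet of `g y` at `y` sends `0` to `g y y`, so the transition element from `g y` to `g x`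
    -- at `y` sends `g y y` to `g x y`. This is why the pointwise definition by `s y y (g y y)`
    -- agrees near `x` with one affine automorphism applied to `g x`.
    have h0 : (affineJet (g y) y)⁻¹ (g y y) = 0 :=
      (congrArg _ (affineJet_zero (hU y y (hmem y)).2).symm).trans
        ((affineJet (g y) y).symm_apply_apply 0)
    change s x y (affineJet (g x) y ((affineJet (g y) y)⁻¹ (g y y))) = s x y (g x y)
    rw [h0, affineJet_zero (hU x y hyU).2]
  refine ⟨((hU x x (hmem x)).1.affineEquiv_comp (s x x)).congr hEq, ?_⟩
  have h1 : (mvfderiv (𝓡 m) (fun y => s y y (g y y)) x : TangentSpace (𝓡 m) x → Model m) =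
      mvfderiv (𝓡 m) (fun y => s x x (g x y)) x := funext fun u => mvfderiv_congr hEq u
  rw [h1]
  exact bijective_mvfderiv_affineEquiv_comp (hmd x x (hmem x)) (hU x x (hmem x)).2 _

end Developing

/-! ### Parallel volume form and radial vector field -/

section Volume

variable {m : ℕ} {M : Type*} [TopologicalSpace M] [ChartedSpace (Model m) M]
  [IsManifold (𝓡 m) ∞ M] {D : Connection m M}

theorem contMDiff_mvfderiv_apply {F' : Type*} [NormedAddCommGroup F'] [NormedSpace ℝ F']
    {g : M → F'} (hg : ContMDiff (𝓡 m) 𝓘(ℝ, F') ∞ g) (b : VField m M) :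
    ContMDiff (𝓡 m) 𝓘(ℝ, F') ∞ (fun z => mvfderiv (𝓡 m) g z (b z)) :=
  fun y => contMDiffAt_mvfderiv_apply (hg y) b

/-- The standard volume form of `ℝᵐ`. -/
def stdVolume (m : ℕ) : Model m [⋀^Fin m]→ₗ[ℝ] ℝ :=
  (EuclideanSpace.basisFun (Fin m) ℝ).toBasis.det

/-- The standard volume form of `ℝᵐ` as a continuous multilinear map. -/
def stdVolumeCLM (m : ℕ) : ContinuousMultilinearMap ℝ (fun _ : Fin m => Model m) ℝ :=
  ⟨(stdVolume m).toMultilinearMap, by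
    change Continuous fun v : Fin m → Model m => (EuclideanSpace.basisFun (Fin m) ℝ).toBasis.det v
    simp only [Module.Basis.det_apply]
    refine Continuous.matrix_det (continuous_matrix fun i j => ?_)
    simp only [Module.Basis.toMatrix_apply, OrthonormalBasis.coe_toBasis_repr_apply,
      EuclideanSpace.basisFun_repr]
    fun_prop⟩

/-- The pull-back of the standard volume form of `ℝᵐ` along `g`. -/
def pullbackVolume (g : M → Model m) (hg : ContMDiff (𝓡 m) 𝓘(ℝ, Model m) ∞ g) :
    DiffForm m M m where
  form x := (stdVolume m).compLinearMap (mvfderiv (𝓡 m) g x).toLinearMap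
  smooth X := (stdVolumeCLM m).contDiff.contMDiff.comp
    (contMDiff_pi_space.2 fun i => contMDiff_mvfderiv_apply hg (X i))

theorem isVolume_pullbackVolume {g : M → Model m} (hg : ContMDiff (𝓡 m) 𝓘(ℝ, Model m) ∞ g)
    (h : ∀ y, Function.Bijective (mvfderiv (𝓡 m) g y)) : (pullbackVolume g hg).IsVolume := by
  intro x hx
  choose u hu using fun i => (h x).2 ((EuclideanSpace.basisFun (Fin m) ℝ).toBasis i)
  have h1 : stdVolume m (fun i => mvfderiv (𝓡 m) g x (u i)) = 0 := congr($hx u)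
  simp only [hu] at h1
  exact one_ne_zero ((Module.Basis.det_self _).symm.trans h1)

/-- Differentiating the determinant of the functions `b_i g` along `a` replaces one entry at a time
by `a(b_i g)`, which equals `(D_a b_i) g` since the Hessian of `g` vanishes. -/
theorem isParallel_pullbackVolume (hD : IsLocallyFlat D) {g : M → Model m}
    (hg : ContMDiff (𝓡 m) 𝓘(ℝ, Model m) ∞ g) (h : ∀ y, HessianVanishes D hD.smooth g y) :
    (pullbackVolume g hg).IsParallel D hD := by
  intro a b
  ext x
  have h1 : ∀ i, HasMFDerivAt (𝓡 m) 𝓘(ℝ, Model m) (fun z => mvfderiv (𝓡 m) g z (b i z)) x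
      (mvfderiv (𝓡 m) (fun z => mvfderiv (𝓡 m) g z (b i z)) x) := fun i =>
    ((contMDiff_mvfderiv_apply hg (b i)).mdifferentiable (by simp) x).hasMFDerivAt
  have hp : HasMFDerivAt (𝓡 m) 𝓘(ℝ, Fin m → Model m) (fun z i => mvfderiv (𝓡 m) g z (b i z)) x
      (ContinuousLinearMap.pi fun i =>
        mvfderiv (𝓡 m) (fun z => mvfderiv (𝓡 m) g z (b i z)) x) :=
    ⟨continuousAt_pi.2 fun i => (h1 i).1, hasFDerivWithinAt_pi.2 fun i => (h1 i).2⟩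
  have h2 := (((stdVolumeCLM m).hasFDerivAt
    (fun i => mvfderiv (𝓡 m) g x (b i x))).hasMFDerivAt.comp x hp).mfderiv
  have h3 : lieD a ((pullbackVolume g hg).toCochain b) x =
      (stdVolumeCLM m).linearDeriv (fun i => mvfderiv (𝓡 m) g x (b i x))
        (fun i => mvfderiv (𝓡 m) (fun z => mvfderiv (𝓡 m) g z (b i z)) x (a x)) := congr($h2 (a x))
  rw [h3, ContinuousMultilinearMap.linearDeriv_apply]
  refine Eq.trans (Finset.sum_congr rfl fun i _ => ?_)
    (map_sum (⟨⟨fun w => w x, rfl⟩, fun _ _ => rfl⟩ : SmoothFun m M →+ ℝ) _ _).symm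
  change _ = stdVolumeCLM m fun j => mvfderiv (𝓡 m) g x (Function.update b i _ j x)
  congr 1
  funext j
  by_cases hj : j = i
  · subst hj
    simp [h x a (b j)]
  · simp [hj]

/-- The radial vector field of `ℝᵐ`. -/
def radialField (z : Model m) : TangentSpace (𝓡 m) z := z

/-- `E` is the pull-back of the Euler field `z ↦ z`. It is defined on the whole manifold because the
differential of `g` is invertible everywhere; injectivity of `g` plays no role. -/
theorem exists_radial_field {g : M → Model m} (hg : ContMDiff (𝓡 m) 𝓘(ℝ, Model m) ∞ g)
    (h : ∀ y, Function.Bijective (mvfderiv (𝓡 m) g y)) :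
    ∃ E : VField m M, ∀ y, mvfderiv (𝓡 m) g y (E y) = g y := by
  have hinv : ∀ y, (mfderiv (𝓡 m) (𝓡 m) g y).IsInvertible := fun y => by
    let L : Model m →L[ℝ] Model m := mfderiv (𝓡 m) (𝓡 m) g y
    have hL : Function.Bijective L.toLinearMap := h y
    change L.IsInvertible
    exact ⟨(LinearEquiv.ofBijective L.toLinearMap hL).toContinuousLinearEquiv, rfl⟩
  refine ⟨⟨VectorField.mpullback (𝓡 m) (𝓡 m) g radialField, ?_⟩, fun y => ?_⟩
  · refine ContMDiff.mpullback_vectorField (n := ∞) ?_ hg hinv (by simp)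
    intro z
    exact contMDiffAt_vectorSpace_iff_contDiffAt.2 contDiffAt_id
  · obtain ⟨e, he⟩ := hinv y
    change mfderiv (𝓡 m) (𝓡 m) g y
      (VectorField.mpullback (𝓡 m) (𝓡 m) g radialField y) = _
    rw [VectorField.mpullback_apply, ← he, ContinuousLinearMap.inverse_equiv]
    exact e.apply_symm_apply (g y)

/-- As `E g = g`, vanishing of the Hessian gives `(D_a E) g = a(E g) = a g`, and the differential of
`g` is injective. -/
theorem covD_radial_field {hs : CovariantDerivative.ContMDiffCovariantDerivative D ∞}
    {g : M → Model m} (h : ∀ y, HessianVanishes D hs g y)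
    (hb : ∀ y, Function.Bijective (mvfderiv (𝓡 m) g y)) {E : VField m M}
    (hE : ∀ y, mvfderiv (𝓡 m) g y (E y) = g y) (a : VField m M) : covD D hs a E = a := by
  ext1 y
  refine (hb y).1 ((h y a E).symm.trans ?_)
  rw [funext hE]

end Volume

/-! ### Contraction with the radial field as a primitive -/

section Coboundary

variable {m : ℕ} {M : Type*} [TopologicalSpace M] [ChartedSpace (Model m) M]
  [IsManifold (𝓡 m) ∞ M] {D : Connection m M} {hD : IsLocallyFlat D}

theorem DiffForm.IsParallel.leftAct_eq_zero {k : ℕ} {v : DiffForm m M k} (hv : v.IsParallel D hD)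
    (a : VField m M) : KV.leftAct (kvModule D hD) k a v.toCochain = 0 := by
  ext1 b
  rw [KV.leftAct_apply]
  exact sub_eq_zero.2 (hv a b)

theorem DiffForm.IsParallel.toCochain_mem_cocycles {k : ℕ} {v : DiffForm m M (k + 1)}
    (hv : v.IsParallel D hD) : v.toCochain ∈ KV.cocycles (kvModule D hD) (k + 1) := by
  refine ⟨trivial, LinearMap.mem_ker.2 ?_⟩
  ext1 a
  rw [KV.coboundary_succ_apply]
  refine Finset.sum_eq_zero fun j _ => ?_
  rw [hv.leftAct_eq_zero]
  -- The right action of `kvModule` is zero by definition, so only the left terms of `δ` count; the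
  -- same reduction recurs in the computation of the primitive.
  exact (congrArg _ (add_zero _)).trans (smul_zero _)

/-- Apply parallelism to `(E, b)`: the action on the contraction lacks only the summand in which `a`
differentiates `E`, and that summand is `v(D_a E, b) = v(a, b)`. -/
theorem DiffForm.IsParallel.leftAct_curryLeft {k : ℕ} {v : DiffForm m M (k + 1)}
    (hv : v.IsParallel D hD) {E : VField m M} (hE : ∀ a, covD D hD.smooth a E = a)
    (a : VField m M) (b : Fin k → VField m M) :
    KV.leftAct (kvModule D hD) k a (v.toCochain.curryLeft E) b =
      v.toCochain (Fin.cons a b) := by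
  rw [KV.leftAct_apply]
  have h := hv a (Fin.cons E b)
  rw [Fin.sum_univ_succ, Fin.cons_zero, hE, Fin.update_cons_zero] at h
  simp only [Fin.cons_succ, ← Fin.cons_update] at h
  exact sub_eq_iff_eq_add.2 h

/-- Bringing `a j` to the front takes `j` transpositions (indices counted from zero). -/
theorem DiffForm.toCochain_cons_removeNth {k : ℕ} (v : DiffForm m M (k + 1)) (j : Fin (k + 1))
    (a : Fin (k + 1) → VField m M) :
    v.toCochain (Fin.cons (a j) (j.removeNth a)) = (-1 : ℝ) ^ (j : ℕ) • v.toCochain a := by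
  ext x
  have h := (v.form x).neg_one_pow_smul_map_insertNth j (a j x) (fun i => j.removeNth a i x)
  have h1 : (j.insertNth (α := fun _ => TangentSpace (𝓡 m) x) (a j x)
      (fun i => j.removeNth a i x)) = fun i => a i x :=
    Fin.insertNth_self_removeNth j (fun i => a i x)
  have h2 : (fun i => (Fin.cons (α := fun _ => VField m M) (a j) (j.removeNth a) : _ → VField m M)
      i x) = Matrix.vecCons (a j x) (fun i => j.removeNth a i x) := by
    funext i
    refine Fin.cases rfl (fun i => rfl) i
  rw [h1] at h
  change v.form x _ = (-1 : ℝ) ^ (j : ℕ) • v.form x _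
  rw [h2, ← h, ← Int.cast_smul_eq_zsmul ℝ]
  push_cast
  rfl

theorem DiffForm.IsParallel.toCochain_mem_coboundaries {k : ℕ} {v : DiffForm m M (k + 1)}
    (hv : v.IsParallel D hD) {E : VField m M} (hE : ∀ a, covD D hD.smooth a E = a) :
    v.toCochain ∈ KV.coboundaries (kvModule D hD) (k + 1) := by
  -- Only degree zero needs an argument. There `w = v(E)` satisfies `cw = v(c)` for all `c`, so
  -- `(ab)w = v(ab)`, while `a(bw) = a(v(b)) = v(ab)` by parallelism.
  have hmem : v.toCochain.curryLeft E ∈ KV.cochains (kvModule D hD) k := by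
    cases k with
    | zero =>
      intro a b
      have h1 := fun c => hv.leftAct_curryLeft hE c ![]
      simp only [KV.leftAct_apply, Finset.univ_eq_empty, Finset.sum_empty, sub_zero] at h1
      rw [h1 b, h1]
      refine sub_eq_zero.2 ((hv a ![b]).trans ?_).symm
      rw [Fin.sum_univ_one]
      congr 1
      ext1 i
      fin_cases i
      rfl
    | succ q => trivial
  cases k with
  | zero =>
    -- The sign compensates the minus in `(δw)(a) = -aw`.
    refine ⟨-v.toCochain.curryLeft E, neg_mem hmem, ?_⟩
    ext1 a
    rw [map_neg, neg_apply, KV.coboundary_zero_apply]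
    have h1 := hv.leftAct_curryLeft hE (a 0) ![]
    simp only [KV.leftAct_apply, Finset.univ_eq_empty, Finset.sum_empty, sub_zero] at h1
    rw [h1]
    refine (congrArg _ (add_zero _)).trans ((neg_neg _).trans ?_)
    congr 1
    ext1 i
    fin_cases i
    rfl
  | succ q =>
    -- The form has degree `q + 2` and its contraction degree `q + 1`; the sum defining `δ` omits
    -- the last index, so it has `q + 1` summands, each equal to `-v`.
    refine ⟨(-((q : ℝ) + 1)⁻¹) • v.toCochain.curryLeft E, Submodule.smul_mem _ _ hmem, ?_⟩
    ext1 a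
    have h1 : KV.coboundary (kvModule D hD) (q + 1) (v.toCochain.curryLeft E) a =
        ∑ _j : Fin (q + 1), -v.toCochain a := by
      rw [KV.coboundary_succ_apply]
      refine Finset.sum_congr rfl fun j _ => ?_
      rw [hv.leftAct_curryLeft hE, v.toCochain_cons_removeNth]
      refine (congrArg _ (add_zero _)).trans ?_
      -- The exponent in `δ` is `j + 1` for the zero-based index `j`, against `j` from the
      -- transpositions: the product of the signs is `-1`.
      rw [smul_smul, Fin.val_castSucc, pow_succ, mul_right_comm, ← pow_add, Even.neg_one_pow ⟨_, rfl⟩,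
        one_mul, neg_one_smul]
    rw [map_smul, smul_apply, h1, Finset.sum_const, Finset.card_univ,
      Fintype.card_fin, ← Nat.cast_smul_eq_nsmul ℝ, smul_neg, smul_neg, neg_smul, neg_neg,
      smul_smul, Nat.cast_succ, inv_mul_cancel₀ (by positivity), one_smul]

end Coboundary

end FlatManifold

end
theorem proposition9p2 (m : ℕ) (hm : 1 ≤ m)
    {M : Type*} [TopologicalSpace M] [T2Space M] [SecondCountableTopology M]
    [ChartedSpace (FlatManifold.Model m) M] [IsManifold (𝓡 m) ∞ M]
    {N : Type*} [TopologicalSpace N] [T2Space N] [SecondCountableTopology N]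
    [ChartedSpace (FlatManifold.Model m) N] [IsManifold (𝓡 m) ∞ N]
    (D : FlatManifold.Connection m M) (hD : FlatManifold.IsLocallyFlat D)
    (D' : FlatManifold.Connection m N) (hD' : FlatManifold.IsLocallyFlat D')
    (p : N → M) (hp : FlatManifold.IsUniversalCovering D' D p)
    (hcomplete : FlatManifold.IsComplete D)
    (hunimodular : FlatManifold.HasUnimodularHolonomy D' p) :
    (∃ v : FlatManifold.DiffForm m N m, v.IsVolume ∧ v.IsParallel D' hD') ∧
    ∀ v : FlatManifold.DiffForm m N m, v.IsVolume → v.IsParallel D' hD' →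
      ∃ hv : v.toCochain ∈ KV.cocycles (FlatManifold.kvModule D' hD') m,
        (Submodule.Quotient.mk ⟨v.toCochain, hv⟩ :
          KV.Cohomology (FlatManifold.kvModule D' hD') m) = 0 := by

  have := hp.simplyConnected
  obtain ⟨g, hg⟩ := FlatManifold.exists_developing hD'
  have hsm : ContMDiff (𝓡 m) 𝓘(ℝ, FlatManifold.Model m) ∞ g := fun y => (hg y).1.1
  have hH := fun y => (hg y).1.2
  have hb := fun y => (hg y).2
  refine ⟨⟨FlatManifold.pullbackVolume g hsm, FlatManifold.isVolume_pullbackVolume hsm hb,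
    FlatManifold.isParallel_pullbackVolume hD' hsm hH⟩, fun v _ hv => ?_⟩
  obtain ⟨E, hE⟩ := FlatManifold.exists_radial_field hsm hb
  -- Positive dimension provides a first slot in which to contract with `E`.
  obtain ⟨k, rfl⟩ : ∃ k, m = k + 1 := ⟨m - 1, by omega⟩
  exact ⟨hv.toCochain_mem_cocycles, (Submodule.Quotient.mk_eq_zero _).2
    (hv.toCochain_mem_coboundaries (FlatManifold.covD_radial_field hH hb hE))⟩
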